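/- Let $\sigma_1,\sigma_2,\sigma_3$ be the Pauli matrices $\sigma_x,\sigma_y,\sigma_z$. For a two-qubit state $\rho$ (a density matrix on $\mathbb C^2\otimes\mathbb C^2$) let $$C(\rho)=\max\Big[0,\sqrt{l_1}-\sqrt{l_2}-\sqrt{l_3}-\sqrt{l_4}\Big]$$ be its concurrence, where $l_1\ge l_2\ge l_3\ge l_4$ are the eigenvalues of $\rho(\sigma_y\otimes\sigma_y)\rho^T(\sigma_y\otimes\sigma_y)$, and let $$\beta(\rho)=\max_{a,b,c,d}\operatorname{tr}(\rho\mathcal B),\qquad \mathcal B=\tfrac12\sum_{i,j=1}^3\big[a_i(c_j+d_j)+b_i(c_j-d_j)\big]\sigma_i\otimes\sigma_j ,$$ the maximum being over unit vectors $a,b,c,d\in\mathbb R^3$; the CHSH inequality says that $\operatorname{tr}(\rho\mathcal B)\le 1$ in every local classical model. Call $\rho$ a maximally entangled mixed state if $C(U\rho U^*)\le C(\rho)$ for every unitary $U\in U(4)$. **Theorem.** 1. $\beta(\rho)\ge\sqrt2\,C(\rho)$ for every two-qubit state $\rho$. 2. For every $C\in[0,1]$, over all two-qubit states $\rho$ with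 $C(\rho)=C$, the minimum of $\max[1,\beta(\rho)]$ (the maximal CHSH value, counted from the classical bound $1$) is $\max[1,\sqrt2\,C]$, and the minimum of $\beta(\rho)$ itself is $\sqrt2\,C$. Both minima are attained. 3. For every $C\in[0,1]$ there is a maximally entangled mixed state $\rho$ of rank less than $4$ with $C(\rho)=C$ and $\max[1,\beta(\rho)]=\max[1,\sqrt2\,C]$. 4. Let $\psi$ be a maximally entangled unit vector, $\varphi$ a unit product vector orthogonal to $\psi$, $C\in[0,1]$ and $\rho=C\,|\psi\rangle\langle\psi|+(1-C)\,|\varphi\rangle\langle\varphi|$. Then $\rho$ is a two-qubit state of rank less than $4$ with $C(\rho)=C$ and $\max[1,\beta(\rho)]=\max[1,\sqrt2\,C]$. If $C\ge\frac13$, then $\beta(\rho)=\sqrt2\,C$; if $C\ge\frac12$, then $\rho$ is a maximally entangled mixed state. -/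

import Mathlib

open scoped ComplexOrder Kronecker

namespace TwoQubit

noncomputable section

/-- Operators on `ℂ² ⊗ ℂ²`; the index `(i, j)` stands for the basis vector `|ij⟩`. -/
abbrev Op : Type := Matrix (Fin 2 × Fin 2) (Fin 2 × Fin 2) ℂ

/-- Vectors of `ℂ² ⊗ ℂ²`. -/
abbrev Vec : Type := Fin 2 × Fin 2 → ℂ

/-- Real three-dimensional Euclidean space, where measurement directions live. -/
abbrev Dir : Type := EuclideanSpace ℝ (Fin 3)

/-- The Pauli matrices `σ_x, σ_y, σ_z`, with indices `0, 1, 2`. -/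
def pauli : Fin 3 → Matrix (Fin 2) (Fin 2) ℂ :=
  ![!![0, 1; 1, 0], !![0, -Complex.I; Complex.I, 0], !![1, 0; 0, -1]]

/-- A two-qubit state: a density matrix on `ℂ² ⊗ ℂ²`. -/
def IsState (ρ : Op) : Prop := ρ.PosSemidef ∧ ρ.trace = 1

/-- The Bell operator of the CHSH inequality,
`½ ∑ᵢⱼ [aᵢ (cⱼ + dⱼ) + bᵢ (cⱼ - dⱼ)] σᵢ ⊗ σⱼ`. -/
def bellOp (a b c d : Dir) : Op :=
  (1 / 2 : ℂ) • ∑ i : Fin 3, ∑ j : Fin 3,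
    ((a i * (c j + d j) + b i * (c j - d j) : ℝ) : ℂ) • (pauli i ⊗ₖ pauli j)

/-- The expectation values `tr (ρ B)` over all Bell operators `B`. -/
def bellValues (ρ : Op) : Set ℝ :=
  {t | ∃ a b c d : Dir, ‖a‖ = 1 ∧ ‖b‖ = 1 ∧ ‖c‖ = 1 ∧ ‖d‖ = 1 ∧
    t = ((ρ * bellOp a b c d).trace).re}

/-- The maximal CHSH value `β(ρ) = max_B tr (ρ B)`; local classical models give at most `1`. -/
def maxCHSH (ρ : Op) : ℝ := sSup (bellValues ρ)

/-- The matrix `ρ (σ_y ⊗ σ_y) ρᵀ (σ_y ⊗ σ_y)`. -/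
def spinFlipProduct (ρ : Op) : Op :=
  ρ * (pauli 1 ⊗ₖ pauli 1) * ρ.transpose * (pauli 1 ⊗ₖ pauli 1)

/-- The eigenvalues of `ρ (σ_y ⊗ σ_y) ρᵀ (σ_y ⊗ σ_y)` with algebraic multiplicity (for a state
they are real and nonnegative), in decreasing order. -/
def spinFlipEigenvalues (ρ : Op) : List ℝ :=
  ((spinFlipProduct ρ).charpoly.roots.map Complex.re).sort (· ≥ ·)

/-- Wootters' concurrence `C(ρ) = max [0, √l₁ - √l₂ - √l₃ - √l₄]`. -/
def concurrence (ρ : Op) : ℝ :=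
  max 0 (√((spinFlipEigenvalues ρ).getD 0 0) - √((spinFlipEigenvalues ρ).getD 1 0)
    - √((spinFlipEigenvalues ρ).getD 2 0) - √((spinFlipEigenvalues ρ).getD 3 0))

/-- A maximally entangled mixed state: a state whose concurrence (equivalently, whose entanglement
of formation) cannot be increased by any global unitary transformation. -/
def IsMaximallyEntangledMixed (ρ : Op) : Prop :=
  IsState ρ ∧ ∀ U ∈ Matrix.unitaryGroup (Fin 2 × Fin 2) ℂ,
    concurrence (U * ρ * U.conjTranspose) ≤ concurrence ρ

/-- A maximally entangled unit vector: its reduced density matrix on the first qubit is `½ I`. -/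
def IsMaximallyEntangledVec (ψ : Vec) : Prop :=
  ∀ i i' : Fin 2, ∑ j : Fin 2, ψ (i, j) * star (ψ (i', j)) = if i = i' then 1 / 2 else 0

/-- A unit product vector `u ⊗ v`. -/
def IsProductVec (φ : Vec) : Prop :=
  star φ ⬝ᵥ φ = 1 ∧ ∃ u v : Fin 2 → ℂ, ∀ i j, φ (i, j) = u i * v j

/-- The rank-one operator `|ψ⟩⟨ψ|`. -/
def proj (ψ : Vec) : Op := Matrix.vecMulVec ψ (star ψ)

/-- The mixture `p |ψ⟩⟨ψ| + (1 - p) |φ⟩⟨φ|`. -/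
def mixture (p : ℝ) (ψ φ : Vec) : Op := (p : ℂ) • proj ψ + ((1 - p : ℝ) : ℂ) • proj φ

/-- The supremum in the definition of `maxCHSH` is attained. -/
theorem isGreatest_maxCHSH (ρ : Op) : IsGreatest (bellValues ρ) (maxCHSH ρ) := by
  have hS : IsCompact (Metric.sphere (0 : Dir) 1) := isCompact_sphere 0 1
  have hK := (hS.prod (hS.prod (hS.prod hS)))
  have hc : Continuous (fun q : Dir × Dir × Dir × Dir =>
      ((ρ * bellOp q.1 q.2.1 q.2.2.1 q.2.2.2).trace).re) := by
    unfold bellOp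
    fun_prop
  have himg : bellValues ρ = (fun q : Dir × Dir × Dir × Dir =>
      ((ρ * bellOp q.1 q.2.1 q.2.2.1 q.2.2.2).trace).re) ''
      (Metric.sphere (0 : Dir) 1 ×ˢ Metric.sphere (0 : Dir) 1 ×ˢ
        Metric.sphere (0 : Dir) 1 ×ˢ Metric.sphere (0 : Dir) 1) := by
    ext t
    constructor
    · rintro ⟨a, b, c, d, ha, hb, hc, hd, rfl⟩
      exact ⟨(a, b, c, d), by simp [ha, hb, hc, hd], rfl⟩
    · rintro ⟨⟨a, b, c, d⟩, h, rfl⟩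
      simp only [Set.mem_prod, mem_sphere_zero_iff_norm] at h
      exact ⟨a, b, c, d, h.1, h.2.1, h.2.2.1, h.2.2.2, rfl⟩
  have hcomp : IsCompact (bellValues ρ) := himg ▸ hK.image hc
  have hne : (bellValues ρ).Nonempty := by
    have he : ‖(EuclideanSpace.single 0 1 : Dir)‖ = 1 := by simp
    exact ⟨_, _, _, _, _, he, he, he, he, rfl⟩
  exact hcomp.isGreatest_sSup hne

end

end TwoQubit

namespace TwoQubit

noncomputable section

open Matrix Polynomial

/-! Lower bound. In dimension two `Aᵀ σ_y A = det A • σ_y`, so a local filter `A ⊗ B` with both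
determinants one leaves the spectrum of `spinFlipProduct` unchanged, although it changes the trace.
For `ρ + ε`, `ε > 0`, the trace of the filtered operator has a minimum over `SL₂ × SL₂`
(`exists_min_filteredTrace`). At the minimum both marginals are scalar
(`eq_scalar_of_trace_minimal`), which says that the filtered operator `M` is invariant under the
spin flip. Such an `M` has an eigenbasis of spin-flip-fixed vectors, and `spinFlipProduct M = M *
M`. Its eigenvalues `m k` are therefore the numbers `√lᵢ` of Wootters' formula, for `M` and for `ρ +
ε` alike.

Undoing the filter amounts, up to local unitaries, to applying `diag(p, p⁻¹) ⊗ diag(q, q⁻¹)`. One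
explicit Bell operator has expectation `2√2 Re ρ₀₀,₁₁`. After a suitable unitary on the second qubit
this entry is a sum `∑ m k * T k` with `T k₀ = l / 2`, every `T k ≥ -l / 2` and `l ≥ 1`. This gives
`√2 (2 m k₀ - ∑ m k)`, which is `√2 C` when `m k₀` is the largest and the bracket is nonnegative
(`sqrt_two_mul_le_maxCHSH_of_filt`). A compactness argument lets `ε` tend to `0`.

Sharpness. The states `famState l₁ l₂ l₃` have concurrence `l₁ - l₃` and a diagonal correlation
matrix with entries `l₁ - l₃`, `l₁ - l₃`, `l₂ - l₁ - l₃`. Elementary inequalities then give `β ≤ √2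
C` or `β ≤ 1` for suitable weights. They are maximally entangled mixed states when `l₁ ≥ l₂ ≥ l₃`,
because a singular value estimate bounds the concurrence of every state with that spectrum by `l₁ -
l₃` (`concurrence_conj_diagonal_le`). The mixtures of part 4 are such states up to local unitaries.
-/

/-- The index set of the computational basis of `ℂ² ⊗ ℂ²`. -/
abbrev Idx : Type := Fin 2 × Fin 2

/-! ### The spin flip, and the concurrence under local operators -/

/-- The spin flip operator `σ_y ⊗ σ_y`. -/
abbrev flip : Op := pauli 1 ⊗ₖ pauli 1

theorem sum_idx {M : Type*} [AddCommMonoid M] (f : Idx → M) :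
    ∑ k, f k = f (0, 0) + f (0, 1) + f (1, 0) + f (1, 1) := by
  rw [Fintype.sum_prod_type, Fin.sum_univ_two, Fin.sum_univ_two, Fin.sum_univ_two, add_assoc,
    add_assoc, add_assoc]

theorem op_ext {A B : Op} (h : ∀ i j k l, A (i, j) (k, l) = B (i, j) (k, l)) : A = B := by
  ext ⟨i, j⟩ ⟨k, l⟩
  exact h i j k l

theorem flip_transpose : flipᵀ = flip := by
  refine op_ext fun i j k l => ?_
  fin_cases i <;> fin_cases j <;> fin_cases k <;> fin_cases l <;>
    simp [flip, kroneckerMap_apply, pauli]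

theorem flip_mul_flip : flip * flip = 1 := by
  rw [flip, ← mul_kronecker_mul, ← one_kronecker_one]
  congr 1 <;>
  · ext i j
    fin_cases i <;> fin_cases j <;> simp [pauli]

theorem flip_conjTranspose : flipᴴ = flip := by
  refine op_ext fun i j k l => ?_
  fin_cases i <;> fin_cases j <;> fin_cases k <;> fin_cases l <;>
    simp [flip, kroneckerMap_apply, pauli]

theorem flip_map_star : flip.map star = flip := by
  have h := flip_conjTranspose
  rwa [conjTranspose, flip_transpose] at h

/-- `σ_y` is a multiple of the alternating form on `ℂ²`, which a matrix rescales by its determinant.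
This is why determinant-one filters preserve the spin-flip spectrum. -/
theorem kronecker_transpose_mul_flip_mul (A B : Matrix (Fin 2) (Fin 2) ℂ) :
    (A ⊗ₖ B)ᵀ * flip * (A ⊗ₖ B) = (A.det * B.det) • flip := by
  have h : ∀ A : Matrix (Fin 2) (Fin 2) ℂ, Aᵀ * pauli 1 * A = A.det • pauli 1 := by
    intro A
    ext i j
    fin_cases i <;> fin_cases j <;>
      simp [pauli, mul_apply, Fin.sum_univ_two, det_fin_two] <;> ring
  rw [flip, ← kroneckerMap_transpose, ← mul_kronecker_mul, ← mul_kronecker_mul, h, h,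
    smul_kronecker, kronecker_smul, smul_smul]

/-- The concurrence in terms of the square roots `m k` of the eigenvalues, in any order. -/
theorem concurrence_eq_of_charpoly {ρ : Op} {m : Idx → ℝ} (hm : ∀ k, 0 ≤ m k)
    (h : (spinFlipProduct ρ).charpoly = ∏ k, (X - C (((m k ^ 2 : ℝ) : ℂ)))) {k₀ : Idx}
    (hk : ∀ k, m k ≤ m k₀) : concurrence ρ = max 0 (2 * m k₀ - ∑ k, m k) := by
  have hroots : (spinFlipProduct ρ).charpoly.roots.map Complex.re
      = Finset.univ.val.map fun k => m k ^ 2 := by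
    have h' : ∏ k, (X - C (((m k ^ 2 : ℝ) : ℂ)))
        = ((Finset.univ.val.map fun k => ((m k ^ 2 : ℝ) : ℂ)).map fun a => X - C a).prod := by
      rw [Multiset.map_map]
      rfl
    rw [h, h', roots_multiset_prod_X_sub_C, Multiset.map_map]
    refine Multiset.map_congr rfl fun k _ => ?_
    exact Complex.ofReal_re _
  have hcoe : ((spinFlipEigenvalues ρ : List ℝ) : Multiset ℝ)
      = Finset.univ.val.map fun k => m k ^ 2 := by
    rw [spinFlipEigenvalues, Multiset.sort_eq, hroots]
  have hsorted : (spinFlipEigenvalues ρ).Pairwise (· ≥ ·) := Multiset.pairwise_sort _ _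
  have hlen : (spinFlipEigenvalues ρ).length = 4 := by
    have := congrArg Multiset.card hcoe
    simpa using this
  unfold concurrence
  generalize spinFlipEigenvalues ρ = l at *
  match l, hlen with
  | [a, b, c, d], _ =>
    have hsum : √a + √b + √c + √d = ∑ k, m k := by
      have := congrArg (fun s : Multiset ℝ => (s.map Real.sqrt).sum) hcoe
      simp only [Multiset.map_map, Multiset.map_coe, Multiset.sum_coe] at this
      simp only [List.map_cons, List.map_nil, List.sum_cons, List.sum_nil, Function.comp_def,
        Real.sqrt_sq (hm _)] at this
      rw [Finset.sum, ← this]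
      ring
    have hmem : ∀ x, x ∈ [a, b, c, d] ↔ ∃ k, m k ^ 2 = x := by
      intro x
      rw [← Multiset.mem_coe, hcoe]
      simp
    -- The head of the decreasingly sorted list is the largest square, hence that of `m k₀`; the
    -- order of the other three does not matter, since only their sum enters.
    have hmax : √a = m k₀ := by
      obtain ⟨k, hka⟩ := (hmem a).1 (by simp)
      have h1 : m k₀ ^ 2 ≤ a := by
        have := (hmem (m k₀ ^ 2)).2 ⟨k₀, rfl⟩
        simp only [List.pairwise_cons] at hsorted
        rcases List.mem_cons.1 this with h | h
        · exact h.le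
        · exact hsorted.1 _ h
      have h2 : a ≤ m k₀ ^ 2 := hka ▸ pow_le_pow_left₀ (hm k) (hk k) 2
      rw [le_antisymm h2 h1, Real.sqrt_sq (hm _)]
    simp only [List.getD_cons_zero, List.getD_cons_succ]
    congr 1
    rw [← hsum, ← hmax]
    ring

theorem conjTranspose_mul_flip_mul {W : Op} {z : ℂ} (hW : Wᵀ * flip * W = z • flip) :
    Wᴴ * flip * Wᴴᵀ = star z • flip := by
  have h := congrArg (fun A : Op => A.map star) hW
  have h1 : (Wᵀ * flip * W).map star = (Wᵀ * flip * W)ᵀᴴ := by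
    rw [conjTranspose, transpose_transpose]
  have h2 : (z • flip).map star = star z • flip := by
    rw [← congrArg (fun A : Op => star z • A) flip_map_star]
    ext; simp
  rw [h1, h2] at h
  rw [← h]
  simp only [transpose_mul, conjTranspose_mul, transpose_transpose, flip_transpose,
    flip_conjTranspose, Matrix.mul_assoc]
  rfl

/-- Moving `W` cyclically to the right end leaves only the blocks `Wᴴ * flip * Wᴴᵀ` and `Wᵀ * flip *
W`, whose scalars `star z` and `z` cancel. `W` need not be unitary, so both local unitaries and
determinant-one filters are covered. -/
theorem charpoly_spinFlipProduct_conj {W : Op} {z : ℂ} (hW : Wᵀ * flip * W = z • flip)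
    (hz : z * star z = 1) (ρ : Op) :
    (spinFlipProduct (W * ρ * Wᴴ)).charpoly = (spinFlipProduct ρ).charpoly := by
  have hW' := conjTranspose_mul_flip_mul hW
  have e : spinFlipProduct (W * ρ * Wᴴ) = W * (ρ * (Wᴴ * flip * Wᴴᵀ) * ρᵀ * (Wᵀ * flip)) := by
    simp only [spinFlipProduct, transpose_mul, Matrix.mul_assoc]
  rw [e, charpoly_mul_comm, hW']
  have e2 : ρ * (star z • flip) * ρᵀ * (Wᵀ * flip) * W
      = ρ * (star z • flip) * ρᵀ * (Wᵀ * flip * W) := by simp only [Matrix.mul_assoc]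
  rw [e2, hW]
  simp only [Matrix.mul_smul, Matrix.smul_mul, smul_smul, hz, one_smul]
  rfl

theorem concurrence_eq_of_charpoly_eq {ρ σ : Op}
    (h : (spinFlipProduct ρ).charpoly = (spinFlipProduct σ).charpoly) :
    concurrence ρ = concurrence σ := by
  rw [concurrence, concurrence, spinFlipEigenvalues, spinFlipEigenvalues, h]

theorem det_mul_star_det_of_unitary {U : Matrix (Fin 2) (Fin 2) ℂ}
    (hU : U * Uᴴ = 1) : U.det * star U.det = 1 := by
  have := congrArg det hU
  rwa [det_mul, det_conjTranspose, det_one] at this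

theorem charpoly_spinFlipProduct_local {U V : Matrix (Fin 2) (Fin 2) ℂ} (hU : U * Uᴴ = 1)
    (hV : V * Vᴴ = 1) (ρ : Op) :
    (spinFlipProduct ((U ⊗ₖ V) * ρ * (U ⊗ₖ V)ᴴ)).charpoly = (spinFlipProduct ρ).charpoly := by
  refine charpoly_spinFlipProduct_conj (kronecker_transpose_mul_flip_mul U V) ?_ ρ
  rw [star_mul', mul_mul_mul_comm, det_mul_star_det_of_unitary hU,
    det_mul_star_det_of_unitary hV, one_mul]

theorem concurrence_local {U V : Matrix (Fin 2) (Fin 2) ℂ} (hU : U * Uᴴ = 1) (hV : V * Vᴴ = 1)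
    (ρ : Op) : concurrence ((U ⊗ₖ V) * ρ * (U ⊗ₖ V)ᴴ) = concurrence ρ :=
  concurrence_eq_of_charpoly_eq (charpoly_spinFlipProduct_local hU hV ρ)

/-! ### Bell operators, and the CHSH value under local unitaries -/

/-- The observable `n · σ`. -/
def sig (n : Dir) : Matrix (Fin 2) (Fin 2) ℂ :=
  !![(n 2 : ℂ), n 0 - Complex.I * n 1; n 0 + Complex.I * n 1, -(n 2 : ℂ)]

theorem bellOp_eq (a b c d : Dir) :
    bellOp a b c d = (1 / 2 : ℂ) • (sig a ⊗ₖ (sig c + sig d) + sig b ⊗ₖ (sig c - sig d)) := by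
  rw [bellOp]
  congr 1
  refine op_ext fun i j k l => ?_
  simp only [Fin.sum_univ_three, Matrix.add_apply, Matrix.smul_apply, kroneckerMap_apply,
    smul_eq_mul, Matrix.sub_apply, sig, pauli]
  fin_cases i <;> fin_cases k <;> fin_cases j <;> fin_cases l <;>
    simp <;> ring_nf <;> simp only [Complex.I_sq] <;> ring

theorem norm_dir_sq (a : Dir) : ‖a‖ ^ 2 = a 0 ^ 2 + a 1 ^ 2 + a 2 ^ 2 := by
  simp [EuclideanSpace.norm_sq_eq, Fin.sum_univ_three]

theorem det_sig (a : Dir) : (sig a).det = -((‖a‖ ^ 2 : ℝ) : ℂ) := by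
  rw [norm_dir_sq, sig, det_fin_two_of]
  push_cast
  ring_nf
  simp only [Complex.I_sq]
  ring

theorem exists_sig_eq {A : Matrix (Fin 2) (Fin 2) ℂ} (hA : A.IsHermitian) (htr : A.trace = 0) :
    ∃ n : Dir, A = sig n := by
  have h11 : A 1 1 = -A 0 0 := by
    rw [trace_fin_two] at htr
    linear_combination htr
  have h00 : star (A 0 0) = A 0 0 := hA.apply 0 0
  have h01 : star (A 1 0) = A 0 1 := hA.apply 0 1
  have him : (A 0 0).im = 0 := by
    have := congrArg Complex.im h00
    simp at this
    linarith
  refine ⟨!₂[(A 1 0).re, (A 1 0).im, (A 0 0).re], ?_⟩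
  ext i j
  fin_cases i <;> fin_cases j <;>
    simp [sig, h11, ← h01, Complex.ext_iff, him]

theorem sig_isHermitian (a : Dir) : (sig a).IsHermitian := by
  ext i j
  fin_cases i <;> fin_cases j <;> simp [sig]
  ring

/-- Conjugation keeps `n · σ` Hermitian and traceless, and `det (n · σ) = -‖n‖²` shows that the
direction keeps its length. -/
theorem exists_conj_sig {U : Matrix (Fin 2) (Fin 2) ℂ} (hU : U * Uᴴ = 1) (a : Dir) :
    ∃ a' : Dir, ‖a'‖ = ‖a‖ ∧ Uᴴ * sig a * U = sig a' := by
  obtain ⟨a', ha'⟩ := exists_sig_eq (A := Uᴴ * sig a * U)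
    (isHermitian_conjTranspose_mul_mul U (sig_isHermitian a)) (by
      rw [trace_mul_comm, ← Matrix.mul_assoc, hU, Matrix.one_mul, trace_fin_two]
      simp [sig])
  refine ⟨a', ?_, ha'⟩
  have h := congrArg det ha'
  rw [det_mul, det_mul, det_sig, det_sig] at h
  have h2 : (Uᴴ).det * U.det = 1 := by
    rw [← det_mul, mul_eq_one_comm.1 hU, det_one]
  have h3 : ((‖a‖ ^ 2 : ℝ) : ℂ) = ((‖a'‖ ^ 2 : ℝ) : ℂ) := by
    linear_combination -h - ((‖a‖ ^ 2 : ℝ) : ℂ) * h2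
  have h4 : ‖a‖ ^ 2 = ‖a'‖ ^ 2 := by exact_mod_cast h3
  exact ((pow_left_inj₀ (norm_nonneg _) (norm_nonneg _) two_ne_zero).1 h4).symm

theorem bellValues_local_subset {U V : Matrix (Fin 2) (Fin 2) ℂ} (hU : U * Uᴴ = 1)
    (hV : V * Vᴴ = 1) (ρ : Op) :
    bellValues ((U ⊗ₖ V) * ρ * (U ⊗ₖ V)ᴴ) ⊆ bellValues ρ := by
  rintro t ⟨a, b, c, d, ha, hb, hc, hd, rfl⟩
  obtain ⟨a', ha', ea⟩ := exists_conj_sig hU a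
  obtain ⟨b', hb', eb⟩ := exists_conj_sig hU b
  obtain ⟨c', hc', ec⟩ := exists_conj_sig hV c
  obtain ⟨d', hd', ed⟩ := exists_conj_sig hV d
  refine ⟨a', b', c', d', ha'.trans ha, hb'.trans hb, hc'.trans hc, hd'.trans hd, ?_⟩
  have e : (U ⊗ₖ V)ᴴ * bellOp a b c d * (U ⊗ₖ V) = bellOp a' b' c' d' := by
    rw [bellOp_eq, bellOp_eq, conjTranspose_kronecker, Matrix.mul_smul, Matrix.smul_mul,
      Matrix.mul_add, Matrix.add_mul]
    simp only [← mul_kronecker_mul, Matrix.mul_add, Matrix.add_mul, Matrix.mul_sub,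
      Matrix.sub_mul, ea, eb, ec, ed]
  rw [← e, Matrix.mul_assoc, Matrix.mul_assoc, trace_mul_comm]
  simp only [Matrix.mul_assoc]

theorem kronecker_mul_conjTranspose {U V : Matrix (Fin 2) (Fin 2) ℂ} (hU : U * Uᴴ = 1)
    (hV : V * Vᴴ = 1) : (U ⊗ₖ V) * (U ⊗ₖ V)ᴴ = 1 := by
  rw [conjTranspose_kronecker, ← mul_kronecker_mul, hU, hV, one_kronecker_one]

theorem maxCHSH_local {U V : Matrix (Fin 2) (Fin 2) ℂ} (hU : U * Uᴴ = 1)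
    (hV : V * Vᴴ = 1) (ρ : Op) : maxCHSH ((U ⊗ₖ V) * ρ * (U ⊗ₖ V)ᴴ) = maxCHSH ρ := by
  rw [maxCHSH, maxCHSH]
  congr 1
  refine (bellValues_local_subset hU hV ρ).antisymm ?_
  have h := bellValues_local_subset (U := Uᴴ) (V := Vᴴ)
    (by rw [conjTranspose_conjTranspose]; exact mul_eq_one_comm.1 hU)
    (by rw [conjTranspose_conjTranspose]; exact mul_eq_one_comm.1 hV)
    ((U ⊗ₖ V) * ρ * (U ⊗ₖ V)ᴴ)
  have h1 : (U ⊗ₖ V)ᴴ * (U ⊗ₖ V) = 1 := mul_eq_one_comm.1 (kronecker_mul_conjTranspose hU hV)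
  have e : (Uᴴ ⊗ₖ Vᴴ) * ((U ⊗ₖ V) * ρ * (U ⊗ₖ V)ᴴ) * (Uᴴ ⊗ₖ Vᴴ)ᴴ = ρ := by
    rw [← conjTranspose_kronecker, conjTranspose_conjTranspose]
    simp only [Matrix.mul_assoc, h1, Matrix.mul_one]
    rw [← Matrix.mul_assoc, h1, Matrix.one_mul]
  rwa [e] at h

theorem le_maxCHSH (ρ : Op) {a b c d : Dir} (ha : ‖a‖ = 1) (hb : ‖b‖ = 1) (hc : ‖c‖ = 1)
    (hd : ‖d‖ = 1) : ((ρ * bellOp a b c d).trace).re ≤ maxCHSH ρ :=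
  (isGreatest_maxCHSH ρ).2 ⟨a, b, c, d, ha, hb, hc, hd, rfl⟩

theorem sig_neg (a : Dir) : sig (-a) = -sig a := by
  ext i j
  fin_cases i <;> fin_cases j <;> simp [sig] <;> ring

theorem maxCHSH_nonneg (ρ : Op) : 0 ≤ maxCHSH ρ := by
  have he : ‖(EuclideanSpace.single 0 1 : Dir)‖ = 1 := by simp
  set e : Dir := EuclideanSpace.single 0 1
  have hn : ‖-e‖ = 1 := by rwa [norm_neg]
  have h1 := le_maxCHSH ρ he he he he
  have h2 := le_maxCHSH ρ hn hn he he
  have e1 : bellOp (-e) (-e) e e = -bellOp e e e e := by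
    have hk : ∀ A B : Matrix (Fin 2) (Fin 2) ℂ, (-A) ⊗ₖ B = -(A ⊗ₖ B) := by
      intro A B
      ext; simp
    rw [bellOp_eq, bellOp_eq, sig_neg, hk, hk, ← neg_add, smul_neg]
  rw [e1, Matrix.mul_neg, trace_neg, Complex.neg_re] at h2
  linarith

/-- With these directions `c + d = √2 e_x` and `c - d = √2 e_y`, so the Bell operator is `(√2/2)(σ_x
⊗ σ_x - σ_y ⊗ σ_y) = √2 (|00⟩⟨11| + |11⟩⟨00|)`. -/
theorem two_sqrt_two_mul_re_le_maxCHSH {ρ : Op} (hρ : ρ.IsHermitian) :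
    2 * √2 * (ρ (0, 0) (1, 1)).re ≤ maxCHSH ρ := by
  have h2 : √2 * √2 = 2 := Real.mul_self_sqrt (by norm_num)
  have hu : ∀ s : ℝ, s ^ 2 = 1 / 2 → ‖(!₂[√2 / 2, s, 0] : Dir)‖ = 1 := by
    intro s hs
    have : ‖(!₂[√2 / 2, s, 0] : Dir)‖ ^ 2 = 1 := by
      rw [norm_dir_sq]
      simp
      rw [hs, div_pow, Real.sq_sqrt (by norm_num)]
      norm_num
    nlinarith [norm_nonneg (!₂[√2 / 2, s, 0] : Dir)]
  have h := le_maxCHSH ρ (a := !₂[1, 0, 0]) (b := !₂[0, -1, 0]) (c := !₂[√2 / 2, √2 / 2, 0])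
    (d := !₂[√2 / 2, -(√2 / 2), 0])
    (by simp [EuclideanSpace.norm_eq, Fin.sum_univ_three])
    (by simp [EuclideanSpace.norm_eq, Fin.sum_univ_three])
    (hu _ (by nlinarith)) (hu _ (by nlinarith))
  refine le_trans (le_of_eq ?_) h
  have h03 : ρ (1, 1) (0, 0) = star (ρ (0, 0) (1, 1)) := (hρ.apply (1, 1) (0, 0)).symm
  rw [bellOp_eq, trace]
  simp only [sum_idx, diag_apply, mul_apply, Matrix.smul_apply, Matrix.add_apply,
    kroneckerMap_apply, Matrix.sub_apply, sig, smul_eq_mul]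
  simp [h03]
  ring

/-! ### Spin-flip-invariant operators -/

/-- Both scalar fields are needed: invariant operators become real symmetric in the magic basis. -/
theorem exists_spectral_decomposition {𝕜 n : Type*} [RCLike 𝕜] [Fintype n] [DecidableEq n]
    {A : Matrix n n 𝕜} (hA : A.IsHermitian) : ∃ (U : Matrix n n 𝕜) (m : n → ℝ), U * Uᴴ = 1 ∧
      A = U * diagonal (fun k => (m k : 𝕜)) * Uᴴ := by
  refine ⟨hA.eigenvectorUnitary, hA.eigenvalues, ?_, ?_⟩
  · exact Unitary.coe_mul_star_self hA.eigenvectorUnitary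
  · have h := hA.spectral_theorem
    rwa [Unitary.conjStarAlgAut_apply] at h

/-- A unitary matrix whose columns are fixed by the spin flip `ψ ↦ (σ_y ⊗ σ_y) ψ̄`. -/
def magic : Op := fun i j =>
  ((√2 / 2 : ℝ) : ℂ) * (![![![![1, Complex.I], ![0, 0]], ![![0, 0], ![1, Complex.I]]],
    ![![![0, 0], ![1, -Complex.I]], ![![-1, Complex.I], ![0, 0]]]] i.1 i.2 j.1 j.2)

theorem magic_mul_conjTranspose : magic * magicᴴ = 1 := by
  have h2 : (√2 : ℂ) * √2 = 2 := by exact_mod_cast Real.mul_self_sqrt (by norm_num : (0:ℝ) ≤ 2)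
  refine op_ext fun i j k l => ?_
  rw [mul_apply, sum_idx]
  fin_cases i <;> fin_cases j <;> fin_cases k <;> fin_cases l <;>
    simp [magic] <;> ring_nf <;> simp [sq, h2] <;> norm_num

theorem flip_mul_magic : flip * magic.map star = magic := by
  refine op_ext fun i j k l => ?_
  rw [mul_apply, sum_idx]
  fin_cases i <;> fin_cases j <;> fin_cases k <;> fin_cases l <;>
    simp [flip, pauli, magic, map_ofNat]

/-- A positive operator that commutes with the spin flip has an orthonormal eigenbasis of vectors
fixed by the spin flip. -/
theorem exists_flip_real_decomposition {M : Op} (hM : M.PosSemidef)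
    (hflip : flip * Mᵀ * flip = M) : ∃ (G : Op) (m : Idx → ℝ), (∀ k, 0 ≤ m k) ∧ G * Gᴴ = 1 ∧
      flip * G.map star = G ∧ M = G * diagonal (fun k => (m k : ℂ)) * Gᴴ := by
  have hB := magic_mul_conjTranspose
  have hbar : magic.map star = flip * magic := by
    conv_rhs => rw [← flip_mul_magic]
    rw [← Matrix.mul_assoc, flip_mul_flip, Matrix.one_mul]
  have hT : magicᵀ = magicᴴ * flip := by
    have : magicᵀ = (magic.map star)ᴴ := by ext; simp
    rw [this, hbar, conjTranspose_mul, flip_conjTranspose]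
  -- In the magic basis the spin flip is plain complex conjugation. Thus `N` is Hermitian and
  -- symmetric, hence real, and a real orthogonal `Q` diagonalizes it; real combinations of
  -- spin-flip-fixed columns stay fixed.
  set N : Op := magicᴴ * M * magic with hN
  have hNh : N.IsHermitian := isHermitian_conjTranspose_mul_mul magic hM.isHermitian
  have hNt : Nᵀ = N := by
    have e : (magicᴴ)ᵀ = flip * magic := hbar
    rw [hN, transpose_mul, transpose_mul, hT, e]
    conv_rhs => rw [← hflip]
    simp only [Matrix.mul_assoc]
  have hreal : ∀ i j, ((N i j).re : ℂ) = N i j := by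
    intro i j
    have h1 := hNh.apply i j
    have h2 : N j i = N i j := congrFun (congrFun hNt i) j
    rw [h2] at h1
    exact Complex.conj_eq_iff_re.1 h1
  have hR : (N.map Complex.re).IsHermitian := by
    ext i j
    have h2 : N j i = N i j := congrFun (congrFun hNt i) j
    simp [h2]
  obtain ⟨O, m, hO, hOm⟩ := exists_spectral_decomposition hR
  have hmap : (N.map Complex.re).map (fun x : ℝ => (x : ℂ)) = N := by
    ext i j
    exact hreal i j
  set Q : Op := O.map (Complex.ofRealHom) with hQ
  have hQQ : Q * Qᴴ = 1 := by
    have : Qᴴ = Oᴴ.map Complex.ofRealHom := by ext; simp [hQ]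
    rw [this, hQ, ← Matrix.map_mul, hO]
    simp
  have hNQ : N = Q * diagonal (fun k => (m k : ℂ)) * Qᴴ := by
    have e1 : Qᴴ = Oᴴ.map Complex.ofRealHom := by ext; simp [hQ]
    have e2 : diagonal (fun k => (m k : ℂ)) = (diagonal m).map Complex.ofRealHom := by
      rw [diagonal_map (map_zero _)]
      rfl
    rw [e1, e2, hQ, ← Matrix.map_mul, ← Matrix.map_mul]
    conv_lhs => rw [← hmap, hOm]
    rfl
  have hMG : M = magic * Q * diagonal (fun k => (m k : ℂ)) * (magic * Q)ᴴ := by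
    have : M = magic * N * magicᴴ := by
      rw [hN]
      simp only [Matrix.mul_assoc, hB, Matrix.mul_one]
      rw [← Matrix.mul_assoc, hB, Matrix.one_mul]
    rw [this, hNQ, conjTranspose_mul]
    simp only [Matrix.mul_assoc]
  have hGG : (magic * Q) * (magic * Q)ᴴ = 1 := by
    rw [conjTranspose_mul, Matrix.mul_assoc, ← Matrix.mul_assoc Q, hQQ, Matrix.one_mul, hB]
  refine ⟨magic * Q, m, ?_, hGG, ?_, hMG⟩
  · intro k
    have hp := (hM.conjTranspose_mul_mul_same (magic * Q)).diag_nonneg (i := k)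
    have e : (magic * Q)ᴴ * M * (magic * Q) = diagonal (fun k => (m k : ℂ)) := by
      have hGG' := mul_eq_one_comm.1 hGG
      rw [hMG]
      generalize magic * Q = G at hGG'
      simp only [Matrix.mul_assoc, hGG', Matrix.mul_one]
      rw [← Matrix.mul_assoc, hGG', Matrix.one_mul]
    rw [e, diagonal_apply_eq] at hp
    exact_mod_cast hp
  · have : (magic * Q).map star = magic.map star * Q := by
      ext i j
      simp [mul_apply, hQ]
    rw [this, ← Matrix.mul_assoc, flip_mul_magic]

theorem charpoly_conj_diagonal {G : Op} (hG : G * Gᴴ = 1) (d : Idx → ℂ) :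
    (G * diagonal d * Gᴴ).charpoly = ∏ k, (X - C (d k)) := by
  rw [charpoly_mul_comm, ← Matrix.mul_assoc, mul_eq_one_comm.1 hG, Matrix.one_mul,
    charpoly_diagonal]

theorem charpoly_spinFlipProduct_of_flip_real {M G : Op} {m : Idx → ℝ}
    (hflip : flip * Mᵀ * flip = M) (hG : G * Gᴴ = 1)
    (hM : M = G * diagonal (fun k => (m k : ℂ)) * Gᴴ) :
    (spinFlipProduct M).charpoly = ∏ k, (X - C (((m k ^ 2 : ℝ) : ℂ))) := by
  have e : spinFlipProduct M = M * M := by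
    conv_rhs => rw [← hflip]
    conv_lhs => rw [← hflip]
    simp only [spinFlipProduct, Matrix.mul_assoc, hflip]
  have e2 : M * M = G * diagonal (fun k => ((m k ^ 2 : ℝ) : ℂ)) * Gᴴ := by
    have : diagonal (fun k => ((m k ^ 2 : ℝ) : ℂ))
        = diagonal (fun k => (m k : ℂ)) * diagonal (fun k => (m k : ℂ)) := by
      rw [diagonal_mul_diagonal]
      congr 1
      ext k
      push_cast
      ring
    have hG' := mul_eq_one_comm.1 hG
    rw [this, hM]
    simp only [Matrix.mul_assoc]
    rw [← Matrix.mul_assoc Gᴴ G, hG', Matrix.one_mul]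
  rw [e, e2, charpoly_conj_diagonal hG]

/-! ### The CHSH bound for a filtered spin-flip-invariant operator -/

/-- For `κ ≥ 1`, every unit vector `√2 (X, Z)` with nonnegative entries is a top eigenvector of some
matrix `!![c², κ c s; κ c s, s²]` with `c² + s² = 1`, and the top eigenvalue is at least `1`. -/
theorem exists_top_eigenvector_angle {κ X Z : ℝ} (hκ : 1 ≤ κ) (hX : 0 ≤ X) (hZ : 0 ≤ Z)
    (hXZ : X ^ 2 + Z ^ 2 = 1 / 2) : ∃ c s l : ℝ, 0 ≤ c ∧ 0 ≤ s ∧ c ^ 2 + s ^ 2 = 1 ∧ 1 ≤ l ∧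
      c ^ 2 * X ^ 2 + s ^ 2 * Z ^ 2 + 2 * κ * (c * s * X * Z) = l / 2 ∧
      ∀ x z : ℝ, x ^ 2 + z ^ 2 = 1 / 2 →
        c ^ 2 * x ^ 2 + s ^ 2 * z ^ 2 + 2 * κ * (c * s * x * z) ≤ l / 2 := by
  -- Double angles: `(k, l)` is the unit vector at twice the angle of `(X, Z)`. The matrix is half
  -- the identity plus half the traceless symmetric matrix with coordinates `(k', κ l')`, where `k'
  -- = c² - s²` and `l' = 2cs`. Its top eigenvector is `(X, Z)` when `(k', κ l')` is a positive
  -- multiple of `(k, l)`, which forces `k' = κ k / D` and `l' = l / D`, with `D` the normalization.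
  set k := 2 * (X ^ 2 - Z ^ 2) with hk
  set l := 4 * (X * Z) with hl
  have hl0 : 0 ≤ l := by positivity
  have hkl : k ^ 2 + l ^ 2 = 1 := by
    have : k ^ 2 + l ^ 2 = 4 * (X ^ 2 + Z ^ 2) ^ 2 := by rw [hk, hl]; ring
    rw [this, hXZ]; norm_num
  set D := √(κ ^ 2 * k ^ 2 + l ^ 2) with hD
  have hD2 : D ^ 2 = κ ^ 2 * k ^ 2 + l ^ 2 := Real.sq_sqrt (by positivity)
  have hD1 : 1 ≤ D := by
    rw [hD]
    refine Real.one_le_sqrt.2 ?_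
    nlinarith [mul_nonneg (sub_nonneg.2 hκ) (sq_nonneg k),
      mul_nonneg (mul_nonneg (sub_nonneg.2 hκ) (by linarith : (0:ℝ) ≤ κ)) (sq_nonneg k)]
  have hD0 : 0 < D := by linarith
  have hDκ : D ≤ κ := by
    refine abs_le_of_sq_le_sq' ?_ (by linarith) |>.2
    rw [hD2]
    nlinarith [mul_nonneg (mul_nonneg (sub_nonneg.2 hκ) (by linarith : (0:ℝ) ≤ κ + 1))
      (sq_nonneg l)]
  have hk' : (κ * k / D) ^ 2 + (l / D) ^ 2 = 1 := by
    rw [div_pow, div_pow, ← add_div, hD2, mul_pow, div_self]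
    rw [← hD2]; positivity
  set k' := κ * k / D
  set l' := l / D
  have hl'0 : 0 ≤ l' := by positivity
  have hk'b := abs_le_of_sq_le_sq' (show k' ^ 2 ≤ 1 ^ 2 by nlinarith [sq_nonneg l']) (by norm_num)
  have hc2 : √((1 + k') / 2) ^ 2 = (1 + k') / 2 := Real.sq_sqrt (by linarith)
  have hs2 : √((1 - k') / 2) ^ 2 = (1 - k') / 2 := Real.sq_sqrt (by linarith)
  set c := √((1 + k') / 2)
  set s := √((1 - k') / 2)
  have hc0 : 0 ≤ c := Real.sqrt_nonneg _
  have hs0 : 0 ≤ s := Real.sqrt_nonneg _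
  have hcs : 2 * (c * s) = l' := by
    have : (2 * (c * s)) ^ 2 = l' ^ 2 := by
      rw [mul_pow, mul_pow, hc2, hs2]; linarith
    exact (pow_left_inj₀ (by positivity) hl'0 two_ne_zero).1 this
  have hkk : k * k' + κ * (l * l') = κ / D := by
    have : k * k' + κ * (l * l') = κ * (k ^ 2 + l ^ 2) / D := by
      simp only [k', l']; ring
    rw [this, hkl, mul_one]
  have hX2 : X ^ 2 = (1 + k) / 4 := by linarith
  have hZ2 : Z ^ 2 = (1 - k) / 4 := by linarith
  refine ⟨c, s, (1 + κ / D) / 2, hc0, hs0, by rw [hc2, hs2]; ring, ?_, ?_, ?_⟩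
  · have : 1 ≤ κ / D := (one_le_div hD0).2 hDκ
    linarith
  · have : c * s * X * Z = l' * l / 8 := by rw [← hcs, hl]; ring
    rw [this, hc2, hs2, hX2, hZ2]
    linarith
  · intro x z hxz
    have e1 : c * s * x * z = l' * (x * z) / 2 := by rw [← hcs]; ring
    rw [e1, hc2, hs2]
    have hz : z ^ 2 = 1 / 2 - x ^ 2 := by linarith
    -- Cauchy–Schwarz in the double-angle plane: `(k', κ l')` has length `κ / D` and the other
    -- vector has length one.
    have key : 2 * (k' * (x ^ 2 - z ^ 2)) + 4 * (κ * l') * (x * z) ≤ κ / D := by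
      refine abs_le_of_sq_le_sq' ?_ (by positivity) |>.2
      have hlam : (κ / D) ^ 2 = k' ^ 2 + (κ * l') ^ 2 := by
        simp only [k', l']
        have : κ ^ 2 = (κ * k) ^ 2 + (κ * l) ^ 2 := by linear_combination -κ ^ 2 * hkl
        rw [div_pow, mul_div_assoc', div_pow, div_pow, ← add_div, ← this]
      have hone : 4 * (x ^ 2 - z ^ 2) ^ 2 + 16 * (x * z) ^ 2 = 1 := by
        have : 4 * (x ^ 2 - z ^ 2) ^ 2 + 16 * (x * z) ^ 2 = 4 * (x ^ 2 + z ^ 2) ^ 2 := by ring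
        rw [this, hxz]; norm_num
      rw [hlam]
      have := sq_nonneg (k' * (4 * (x * z)) - κ * l' * (2 * (x ^ 2 - z ^ 2)))
      have e : (k' ^ 2 + (κ * l') ^ 2) * (4 * (x ^ 2 - z ^ 2) ^ 2 + 16 * (x * z) ^ 2)
        = (2 * (k' * (x ^ 2 - z ^ 2)) + 4 * (κ * l') * (x * z)) ^ 2
          + (k' * (4 * (x * z)) - κ * l' * (2 * (x ^ 2 - z ^ 2))) ^ 2 := by ring
      rw [hone, mul_one] at e
      linarith
    nlinarith

theorem exists_norm_one_mul_eq_norm (w : ℂ) : ∃ z : ℂ, ‖z‖ = 1 ∧ star z * w = ‖w‖ := by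
  by_cases hw : w = 0
  · exact ⟨1, by simp, by simp [hw]⟩
  · have hn : (‖w‖ : ℂ) ≠ 0 := by simpa using hw
    refine ⟨w / ‖w‖, by simp [hw], ?_⟩
    have : star w * w = (‖w‖ : ℂ) ^ 2 := Complex.conj_mul' w
    rw [star_div₀, div_mul_eq_mul_div, this]
    simp
    field_simp

theorem le_sum_mul_of_neg_le {m T : Idx → ℝ} {l : ℝ} {k₀ : Idx} (hm : ∀ k, 0 ≤ m k)
    (hT : ∀ k, -l ≤ T k) (h₀ : T k₀ = l) : l * (2 * m k₀ - ∑ k, m k) ≤ ∑ k, m k * T k := by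
  have h : ∑ k ∈ Finset.univ.erase k₀, m k * -l ≤ ∑ k ∈ Finset.univ.erase k₀, m k * T k :=
    Finset.sum_le_sum fun k _ => mul_le_mul_of_nonneg_left (hT k) (hm k)
  rw [← Finset.sum_mul] at h
  rw [← Finset.add_sum_erase _ (fun k => m k * T k) (Finset.mem_univ k₀),
    ← Finset.add_sum_erase _ m (Finset.mem_univ k₀), h₀]
  linarith

/-- The local filter `diag(p, p⁻¹)`. -/
def filt (p : ℝ) : Matrix (Fin 2) (Fin 2) ℂ := !![(p : ℂ), 0; 0, (p : ℂ)⁻¹]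

theorem sqrt_two_mul_le_maxCHSH_of_filt {M G : Op} {m : Idx → ℝ} (hm : ∀ k, 0 ≤ m k)
    (hG : G * Gᴴ = 1) (hGf : flip * G.map star = G)
    (hM : M = G * diagonal (fun k => (m k : ℂ)) * Gᴴ) {p q : ℝ} (hp : 0 < p) (hq : 0 < q)
    (k₀ : Idx) : √2 * (2 * m k₀ - ∑ k, m k)
      ≤ maxCHSH ((filt p ⊗ₖ filt q) * M * (filt p ⊗ₖ filt q)ᴴ) := by
  rcases le_or_gt (2 * m k₀ - ∑ k, m k) 0 with hneg | hpos
  · exact (mul_nonpos_of_nonneg_of_nonpos (Real.sqrt_nonneg 2) hneg).trans (maxCHSH_nonneg _)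
  -- A spin-flip-fixed column is determined by its first two entries `g₀, g₁`; it reads `(g₀, g₁,
  -- ḡ₁, -ḡ₀)`.
  have h11 : ∀ k, G (1, 1) k = -star (G (0, 0) k) := by
    intro k
    have := congrFun (congrFun hGf (1, 1)) k
    rw [mul_apply, sum_idx] at this
    rw [← this]
    simp [flip, pauli]
  have h10 : ∀ k, G (1, 0) k = star (G (0, 1) k) := by
    intro k
    have := congrFun (congrFun hGf (1, 0)) k
    rw [mul_apply, sum_idx] at this
    rw [← this]
    simp [flip, pauli]
  have hnorm : ∀ k, ‖G (0, 0) k‖ ^ 2 + ‖G (0, 1) k‖ ^ 2 = 1 / 2 := by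
    intro k
    have hG' : Gᴴ * G = 1 := mul_eq_one_comm.1 hG
    have := congrFun (congrFun hG' k) k
    rw [mul_apply, sum_idx] at this
    simp only [conjTranspose_apply, h11, h10, one_apply_eq, star_neg, star_star, neg_mul_neg]
      at this
    rw [mul_comm (G (0, 1) k), mul_comm (G (0, 0) k)] at this
    have e : ∀ w : ℂ, star w * w = ((‖w‖ ^ 2 : ℝ) : ℂ) := by
      intro w
      rw [Complex.ofReal_pow]
      exact Complex.conj_mul' w
    rw [e, e] at this
    have h : ‖G (0, 0) k‖ ^ 2 + ‖G (0, 1) k‖ ^ 2 + ‖G (0, 1) k‖ ^ 2 + ‖G (0, 0) k‖ ^ 2 = 1 := by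
      exact_mod_cast this
    linarith
  set κ : ℝ := (q ^ 2 + (q⁻¹) ^ 2) / 2 with hκ
  have hqq : q * q⁻¹ = 1 := mul_inv_cancel₀ hq.ne'
  have hκ1 : 1 ≤ κ := by nlinarith [sq_nonneg (q - q⁻¹)]
  obtain ⟨c, s, l, hc, hs, hcs, hl, htop, hall⟩ := exists_top_eigenvector_angle hκ1
    (norm_nonneg _) (norm_nonneg _) (hnorm k₀)
  obtain ⟨z0, hz0, hz0'⟩ := exists_norm_one_mul_eq_norm (G (0, 0) k₀)
  obtain ⟨z1, hz1, hz1'⟩ := exists_norm_one_mul_eq_norm (G (0, 1) k₀)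
  -- The phases `z0`, `z1` align both entries of column `k₀`, and the factor `-I` makes the squares
  -- negative, so that the minus sign in `hentry` turns the `k₀` term into the maximal positive
  -- value `l / 2`.
  set v0 : ℂ := -Complex.I * c * z0 with hv0
  set v1 : ℂ := -Complex.I * s * z1 with hv1
  have hn0 : ‖v0‖ = c := by simp [hv0, hz0, abs_of_nonneg hc]
  have hn1 : ‖v1‖ = s := by simp [hv1, hz1, abs_of_nonneg hs]
  have hvv : star v0 * v0 + star v1 * v1 = 1 := by
    have e0 : star v0 * v0 = (‖v0‖ : ℂ) ^ 2 := Complex.conj_mul' v0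
    have e1 : star v1 * v1 = (‖v1‖ : ℂ) ^ 2 := Complex.conj_mul' v1
    rw [e0, e1, hn0, hn1]
    exact_mod_cast hcs
  set V : Matrix (Fin 2) (Fin 2) ℂ := !![star v0, star v1; -v1, v0] with hV
  have hVV : V * Vᴴ = 1 := by
    ext i j
    fin_cases i <;> fin_cases j <;> simp [hV, mul_apply, Fin.sum_univ_two]
    · simpa using hvv
    · ring
    · ring
    · rw [add_comm, mul_comm v0, mul_comm v1]
      simpa using hvv
  set ρ : Op := (filt p ⊗ₖ filt q) * M * (filt p ⊗ₖ filt q)ᴴ with hρ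
  set Y : Op := ((1 : Matrix (Fin 2) (Fin 2) ℂ) ⊗ₖ V) * (filt p ⊗ₖ filt q) * G with hY
  have hYe : ((1 : Matrix (Fin 2) (Fin 2) ℂ) ⊗ₖ V) * ρ * ((1 : Matrix (Fin 2) (Fin 2) ℂ) ⊗ₖ V)ᴴ
      = Y * diagonal (fun k => (m k : ℂ)) * Yᴴ := by
    rw [hρ, hM, hY]
    simp only [conjTranspose_mul, Matrix.mul_assoc]
  have h1 : (1 : Matrix (Fin 2) (Fin 2) ℂ) * (1 : Matrix (Fin 2) (Fin 2) ℂ)ᴴ = 1 := by simp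
  rw [← maxCHSH_local h1 hVV ρ, hYe]
  have hherm : (Y * diagonal (fun k => (m k : ℂ)) * Yᴴ).IsHermitian := by
    refine isHermitian_mul_mul_conjTranspose Y (isHermitian_diagonal_iff.2 fun i => ?_)
    exact Complex.conj_ofReal _
  refine le_trans ?_ (two_sqrt_two_mul_re_le_maxCHSH hherm)
  have hpc : (p : ℂ) ≠ 0 := by exact_mod_cast hp.ne'
  have hqc : (q : ℂ) ≠ 0 := by exact_mod_cast hq.ne'
  have hY00 : ∀ k, Y (0, 0) k
      = p * (star v0 * q * G (0, 0) k + star v1 * (q : ℂ)⁻¹ * G (0, 1) k) := by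
    intro k
    rw [hY, ← mul_kronecker_mul, Matrix.one_mul, mul_apply, sum_idx]
    simp [hV, filt]
    ring
  have hY11 : ∀ k, star (Y (1, 1) k)
      = -((p : ℂ)⁻¹ * (star v1 * q * G (0, 1) k + star v0 * (q : ℂ)⁻¹ * G (0, 0) k)) := by
    intro k
    rw [hY, ← mul_kronecker_mul, Matrix.one_mul, mul_apply, sum_idx, h11, h10]
    simp [hV, filt]
    ring
  -- The first filter drops out, since `p` and `p⁻¹` multiply to one; the second enters only through
  -- `κ`.
  have hentry : (Y * diagonal (fun k => (m k : ℂ)) * Yᴴ) (0, 0) (1, 1)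
      = ∑ k, (m k : ℂ) * -((star v0 * G (0, 0) k) ^ 2 + (star v1 * G (0, 1) k) ^ 2
        + 2 * κ * (star v0 * G (0, 0) k * (star v1 * G (0, 1) k))) := by
    rw [mul_apply]
    refine Finset.sum_congr rfl fun k _ => ?_
    rw [mul_diagonal, conjTranspose_apply, hY11, hY00, hκ]
    push_cast
    field_simp
    ring
  have hterm : ∀ k, -(l / 2) ≤ (-((star v0 * G (0, 0) k) ^ 2 + (star v1 * G (0, 1) k) ^ 2
        + 2 * κ * (star v0 * G (0, 0) k * (star v1 * G (0, 1) k)))).re := by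
    intro k
    rw [Complex.neg_re, neg_le_neg_iff]
    refine (Complex.re_le_norm _).trans (le_trans ?_ (hall _ _ (hnorm k)))
    refine (norm_add_le _ _).trans (add_le_add ((norm_add_le _ _).trans ?_) ?_)
    · simp only [norm_pow, norm_mul, norm_star, hn0, hn1]
      exact (by ring_nf; rfl)
    · simp only [norm_mul, norm_star, hn0, hn1, Complex.norm_real, Complex.norm_ofNat,
        Real.norm_of_nonneg (zero_le_one.trans hκ1)]
      exact le_of_eq (by ring)
  have hterm0 : (-((star v0 * G (0, 0) k₀) ^ 2 + (star v1 * G (0, 1) k₀) ^ 2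
        + 2 * κ * (star v0 * G (0, 0) k₀ * (star v1 * G (0, 1) k₀)))).re = l / 2 := by
    have ha : star v0 * G (0, 0) k₀ = Complex.I * (c * ‖G (0, 0) k₀‖) := by
      rw [← hz0', hv0]
      simp
      ring
    have hb : star v1 * G (0, 1) k₀ = Complex.I * (s * ‖G (0, 1) k₀‖) := by
      rw [← hz1', hv1]
      simp
      ring
    rw [ha, hb, ← htop]
    have : -((Complex.I * (c * ‖G (0, 0) k₀‖)) ^ 2 + (Complex.I * (s * ‖G (0, 1) k₀‖)) ^ 2
        + 2 * κ * (Complex.I * (c * ‖G (0, 0) k₀‖) * (Complex.I * (s * ‖G (0, 1) k₀‖))))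
        = ((c ^ 2 * ‖G (0, 0) k₀‖ ^ 2 + s ^ 2 * ‖G (0, 1) k₀‖ ^ 2
          + 2 * κ * (c * s * ‖G (0, 0) k₀‖ * ‖G (0, 1) k₀‖) : ℝ) : ℂ) := by
      push_cast
      ring_nf
      simp only [Complex.I_sq]
      ring
    rw [this, Complex.ofReal_re]
  have hsum : l / 2 * (2 * m k₀ - ∑ k, m k)
      ≤ ((Y * diagonal (fun k => (m k : ℂ)) * Yᴴ) (0, 0) (1, 1)).re := by
    rw [hentry, Complex.re_sum]
    simp only [Complex.re_ofReal_mul]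
    exact le_sum_mul_of_neg_le hm hterm hterm0
  have h2 : 0 ≤ √2 := Real.sqrt_nonneg 2
  have h3 : 2 * m k₀ - ∑ k, m k ≤ l * (2 * m k₀ - ∑ k, m k) := le_mul_of_one_le_left hpos.le hl
  have h4 : 2 * m k₀ - ∑ k, m k
      ≤ 2 * ((Y * diagonal (fun k => (m k : ℂ)) * Yᴴ) (0, 0) (1, 1)).re := by linarith
  linarith [mul_le_mul_of_nonneg_left h4 h2]

/-! ### Minimizing the trace over determinant-one local filters -/

/-- Local filters of determinant one do not preserve the trace; this is the trace of the filtered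
operator. -/
def filteredTrace (ρ : Op) (A B : Matrix (Fin 2) (Fin 2) ℂ) : ℝ :=
  ((A ⊗ₖ B) * ρ * (A ⊗ₖ B)ᴴ).trace.re

theorem re_trace_mul_conjTranspose (A : Matrix (Fin 2) (Fin 2) ℂ) :
    (A * Aᴴ).trace = ((‖A 0 0‖ ^ 2 + ‖A 0 1‖ ^ 2 + (‖A 1 0‖ ^ 2 + ‖A 1 1‖ ^ 2) : ℝ) : ℂ) := by
  have e : ∀ w : ℂ, w * star w = ((‖w‖ ^ 2 : ℝ) : ℂ) := by
    intro w
    rw [Complex.ofReal_pow]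
    exact Complex.mul_conj' w
  simp only [trace_fin_two, mul_apply, Fin.sum_univ_two, conjTranspose_apply, e,
    Complex.ofReal_add]

theorem one_le_frobenius_of_det {A : Matrix (Fin 2) (Fin 2) ℂ} (hA : A.det = 1) :
    1 ≤ ‖A 0 0‖ ^ 2 + ‖A 0 1‖ ^ 2 + (‖A 1 0‖ ^ 2 + ‖A 1 1‖ ^ 2) := by
  have h : ‖A.det‖ ≤ ‖A 0 0‖ * ‖A 1 1‖ + ‖A 0 1‖ * ‖A 1 0‖ := by
    rw [det_fin_two]
    refine (norm_sub_le _ _).trans_eq ?_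
    rw [norm_mul, norm_mul]
  rw [hA, norm_one] at h
  nlinarith [sq_nonneg (‖A 0 0‖ - ‖A 1 1‖), sq_nonneg (‖A 0 1‖ - ‖A 1 0‖)]

theorem sq_norm_entry_le_frobenius (A : Matrix (Fin 2) (Fin 2) ℂ) : ∀ i j,
    ‖A i j‖ ^ 2 ≤ ‖A 0 0‖ ^ 2 + ‖A 0 1‖ ^ 2 + (‖A 1 0‖ ^ 2 + ‖A 1 1‖ ^ 2) := by
  have h := fun i j => sq_nonneg ‖A i j‖
  simp only [Fin.forall_fin_two] at h ⊢
  obtain ⟨⟨h1, h2⟩, h3, h4⟩ := h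
  refine ⟨⟨?_, ?_⟩, ?_, ?_⟩ <;> linarith

/-- The summand `ε • 1` contributes `ε ‖A‖² ‖B‖²` in Frobenius norms. This makes the filtered trace
coercive, because determinant one keeps each factor at least `1`. -/
theorem mul_frobenius_le_filteredTrace {ρ₀ : Op} (hρ : ρ₀.PosSemidef) (ε : ℝ)
    (A B : Matrix (Fin 2) (Fin 2) ℂ) :
    ε * ((‖A 0 0‖ ^ 2 + ‖A 0 1‖ ^ 2 + (‖A 1 0‖ ^ 2 + ‖A 1 1‖ ^ 2)) *
      (‖B 0 0‖ ^ 2 + ‖B 0 1‖ ^ 2 + (‖B 1 0‖ ^ 2 + ‖B 1 1‖ ^ 2)))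
      ≤ filteredTrace (ρ₀ + (ε : ℂ) • 1) A B := by
  have h0 : 0 ≤ ((A ⊗ₖ B) * ρ₀ * (A ⊗ₖ B)ᴴ).trace.re :=
    (Complex.le_def.1 (hρ.mul_mul_conjTranspose_same (A ⊗ₖ B)).trace_nonneg).1
  rw [filteredTrace, Matrix.mul_add, Matrix.add_mul, trace_add, Complex.add_re, Matrix.mul_smul,
    Matrix.mul_one, Matrix.smul_mul, trace_smul, conjTranspose_kronecker, ← mul_kronecker_mul,
    trace_kronecker, re_trace_mul_conjTranspose, re_trace_mul_conjTranspose,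
    ← conjTranspose_kronecker, smul_eq_mul, ← Complex.ofReal_mul, ← Complex.ofReal_mul,
    Complex.ofReal_re]
  linarith

theorem exists_min_filteredTrace {ρ₀ : Op} (hρ : ρ₀.PosSemidef) {ε : ℝ} (hε : 0 < ε) :
    ∃ A B : Matrix (Fin 2) (Fin 2) ℂ, A.det = 1 ∧ B.det = 1 ∧ ∀ A' B', A'.det = 1 → B'.det = 1 →
      filteredTrace (ρ₀ + (ε : ℂ) • 1) A B ≤ filteredTrace (ρ₀ + (ε : ℂ) • 1) A' B' := by
  set ρ : Op := ρ₀ + (ε : ℂ) • 1 with hρdef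
  -- A pair doing no worse than `(1, 1)` has squared entries at most `R - 1`, and `2x ≤ x² + 1` then
  -- puts the entries in the ball of radius `R`.
  set R : ℝ := filteredTrace ρ 1 1 / ε + 1 with hR
  set box : Set (Matrix (Fin 2) (Fin 2) ℂ) :=
    Set.univ.pi fun _ => Set.univ.pi fun _ => Metric.closedBall 0 R with hbox
  have hboxc : IsCompact box :=
    isCompact_univ_pi fun _ => isCompact_univ_pi fun _ => isCompact_closedBall 0 R
  set K : Set (Matrix (Fin 2) (Fin 2) ℂ × Matrix (Fin 2) (Fin 2) ℂ) :=
    (box ×ˢ box) ∩ {x | x.1.det = 1 ∧ x.2.det = 1} with hK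
  have hKc : IsCompact K := by
    refine (hboxc.prod hboxc).inter_right (IsClosed.inter ?_ ?_)
    · exact isClosed_eq (by fun_prop) continuous_const
    · exact isClosed_eq (by fun_prop) continuous_const
  have hmemK : ∀ A B : Matrix (Fin 2) (Fin 2) ℂ, A.det = 1 → B.det = 1 →
      filteredTrace ρ A B ≤ filteredTrace ρ 1 1 → (A, B) ∈ K := by
    intro A B hA hB hle
    have h1 := mul_frobenius_le_filteredTrace hρ ε A B
    have hA1 := one_le_frobenius_of_det hA
    have hB1 := one_le_frobenius_of_det hB
    set a := ‖A 0 0‖ ^ 2 + ‖A 0 1‖ ^ 2 + (‖A 1 0‖ ^ 2 + ‖A 1 1‖ ^ 2) with ha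
    set b := ‖B 0 0‖ ^ 2 + ‖B 0 1‖ ^ 2 + (‖B 1 0‖ ^ 2 + ‖B 1 1‖ ^ 2) with hb
    have hab : a * b ≤ R - 1 := by
      rw [hR, add_sub_cancel_right, le_div_iff₀ hε]
      linarith
    have haR : a ≤ R - 1 := by nlinarith
    have hbR : b ≤ R - 1 := by nlinarith
    have hA' : ∀ i j, ‖A i j‖ ≤ R := by
      intro i j
      have := sq_norm_entry_le_frobenius A i j
      nlinarith [sq_nonneg (‖A i j‖ - 1)]
    have hB' : ∀ i j, ‖B i j‖ ≤ R := by
      intro i j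
      have := sq_norm_entry_le_frobenius B i j
      nlinarith [sq_nonneg (‖B i j‖ - 1)]
    refine ⟨⟨?_, ?_⟩, hA, hB⟩
    · exact fun i _ j _ => mem_closedBall_zero_iff.2 (hA' i j)
    · exact fun i _ j _ => mem_closedBall_zero_iff.2 (hB' i j)
  have hcont : Continuous fun x : Matrix (Fin 2) (Fin 2) ℂ × Matrix (Fin 2) (Fin 2) ℂ =>
      filteredTrace ρ x.1 x.2 := by
    unfold filteredTrace
    have hk : Continuous fun x : Matrix (Fin 2) (Fin 2) ℂ × Matrix (Fin 2) (Fin 2) ℂ =>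
        x.1 ⊗ₖ x.2 := by
      refine continuous_matrix fun i j => ?_
      simp only [kroneckerMap_apply]
      fun_prop
    exact Complex.continuous_re.comp
      (((hk.matrix_mul continuous_const).matrix_mul hk.matrix_conjTranspose).matrix_trace)
  have h11 : ((1, 1) : Matrix (Fin 2) (Fin 2) ℂ × Matrix (Fin 2) (Fin 2) ℂ) ∈ K :=
    hmemK 1 1 det_one det_one le_rfl
  clear_value R
  obtain ⟨x, hx, hmin⟩ := hKc.exists_isMinOn ⟨_, h11⟩ hcont.continuousOn
  have hmin' : ∀ y ∈ K, filteredTrace ρ x.1 x.2 ≤ filteredTrace ρ y.1 y.2 := isMinOn_iff.1 hmin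
  refine ⟨x.1, x.2, hx.2.1, hx.2.2, fun A' B' hA' hB' => ?_⟩
  rcases le_total (filteredTrace ρ A' B') (filteredTrace ρ 1 1) with h | h
  · have h2 : (A', B') ∈ K := hmemK A' B' hA' hB' h
    have h3 := hmin' (A', B') h2
    exact h3
  · exact (hmin' _ h11).trans h

/-- A positive `2 × 2` matrix whose trace is minimal on its `SL₂`-orbit is scalar. -/
theorem eq_scalar_of_trace_minimal {N : Matrix (Fin 2) (Fin 2) ℂ} (hN : N.PosSemidef)
    (hmin : ∀ E : Matrix (Fin 2) (Fin 2) ℂ, E.det = 1 → N.trace.re ≤ (E * N * Eᴴ).trace.re) :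
    N 0 0 = N 1 1 ∧ N 0 1 = 0 ∧ N 1 0 = 0 := by
  have h00 := Complex.le_def.1 (hN.diag_nonneg (i := 0))
  have h11 := Complex.le_def.1 (hN.diag_nonneg (i := 1))
  have hconj : N 1 0 = star (N 0 1) := (hN.isHermitian.apply 1 0).symm
  simp only [Complex.zero_re, Complex.zero_im] at h00 h11
  -- Two test families suffice: diagonal filters force equal diagonal entries, and shears force the
  -- off-diagonal entries to vanish.
  have hscale : ∀ t : ℝ, 0 < t →
      (N 0 0).re + (N 1 1).re ≤ t ^ 2 * (N 0 0).re + (t⁻¹) ^ 2 * (N 1 1).re := by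
    intro t ht
    have h := hmin (filt t) (by simp [filt, det_fin_two, ht.ne'])
    refine le_of_le_of_eq (le_of_eq_of_le ?_ h) ?_
    · simp [trace_fin_two]
    · simp only [trace_fin_two, mul_apply, Fin.sum_univ_two, filt, ← Complex.ofReal_inv]
      simp
      ring
  have hshear : ∀ z : ℂ, 0 ≤ 2 * (z * N 1 0).re + ‖z‖ ^ 2 * (N 1 1).re := by
    intro z
    have h := hmin !![1, z; 0, 1] (by simp [det_fin_two])
    have e : (!![1, z; 0, 1] * N * !![1, z; 0, 1]ᴴ).trace.re
        = N.trace.re + (2 * (z * N 1 0).re + ‖z‖ ^ 2 * (N 1 1).re) := by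
      rw [← Complex.normSq_eq_norm_sq, Complex.normSq_apply]
      simp only [trace_fin_two, mul_apply, Fin.sum_univ_two, hconj]
      simp [← h11.2]
      ring
    linarith
  have h10 : N 1 0 = 0 := by
    by_contra hne
    have hpos : 0 < ‖N 1 0‖ ^ 2 := by positivity
    set d := (N 1 1).re
    -- The linear term `-2/(1+d)` beats the quadratic one `d/(1+d)²`, so the expression is negative;
    -- the denominator `1 + d` also serves the case `d = 0`.
    have h := hshear (-((1 / (1 + d) : ℝ) : ℂ) * star (N 1 0))
    have e : star (N 1 0) * N 1 0 = ((‖N 1 0‖ ^ 2 : ℝ) : ℂ) := by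
      rw [Complex.ofReal_pow]; exact Complex.conj_mul' _
    rw [mul_assoc, e, norm_mul, norm_neg, norm_star, Complex.norm_real, neg_mul, Complex.neg_re,
      ← Complex.ofReal_mul, Complex.ofReal_re, mul_pow, Real.norm_eq_abs, sq_abs] at h
    have hd : (1 / (1 + d)) ^ 2 * d ≤ 1 / (1 + d) := by
      have : 0 < 1 + d := by linarith [h11.1]
      rw [div_pow, one_pow, sq, div_mul_eq_mul_div, one_mul, div_le_div_iff₀ (by positivity) this]
      nlinarith
    have hd0 : 0 < 1 / (1 + d) := by
      have := h11.1
      positivity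
    nlinarith [mul_le_mul_of_nonneg_right hd hpos.le, mul_pos hd0 hpos]
  have hscale' : ∀ s : ℝ, 0 < s → 0 ≤ (s - 1) * (s * (N 0 0).re - (N 1 1).re) := by
    intro s hs
    have h := hscale (√s) (Real.sqrt_pos.2 hs)
    rw [inv_pow, Real.sq_sqrt hs.le] at h
    have := mul_le_mul_of_nonneg_left h hs.le
    have e : s * (s * (N 0 0).re + s⁻¹ * (N 1 1).re) = s ^ 2 * (N 0 0).re + (N 1 1).re := by
      field_simp
    nlinarith
  have hre : (N 0 0).re = (N 1 1).re := by
    by_contra hne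
    have hsum : 0 < (N 0 0).re + (N 1 1).re := by
      rcases h00.1.lt_or_eq with h | h
      · linarith [h11.1]
      · rw [← h] at hne ⊢
        rw [zero_add]
        exact lt_of_le_of_ne h11.1 hne
    set x := (N 0 0).re
    set y := (N 1 1).re
    have hsq : 0 < (y - x) ^ 2 := by
      have : y - x ≠ 0 := fun h => hne (by linarith)
      positivity
    rcases h11.1.lt_or_eq with hy | hy
    · have hs : 0 < 2 * y / (x + y) := by positivity
      have h := hscale' _ hs
      have e : (2 * y / (x + y) - 1) * (2 * y / (x + y) * x - y)
          = -(y * (y - x) ^ 2 / (x + y) ^ 2) := by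
        field_simp
        ring
      rw [e] at h
      have : 0 < y * (y - x) ^ 2 / (x + y) ^ 2 := by positivity
      linarith
    · have h := hscale' (1 / 2) (by norm_num)
      rw [← hy] at h hsum
      linarith
  refine ⟨Complex.ext hre (h00.2.symm.trans h11.2), ?_, h10⟩
  rw [← star_star (N 0 1), ← hconj, h10, star_zero]

theorem filteredTrace_mul (ρ : Op) (A B E F : Matrix (Fin 2) (Fin 2) ℂ) :
    filteredTrace ρ (E * A) (F * B)
      = ((E ⊗ₖ F) * ((A ⊗ₖ B) * ρ * (A ⊗ₖ B)ᴴ) * (E ⊗ₖ F)ᴴ).trace.re := by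
  rw [filteredTrace, mul_kronecker_mul, conjTranspose_mul]
  simp only [Matrix.mul_assoc]

/-- Partial trace over the second qubit. -/
def ptraceSnd (M : Op) : Matrix (Fin 2) (Fin 2) ℂ :=
  ∑ j, M.submatrix (fun i => (i, j)) (fun i => (i, j))

/-- Partial trace over the first qubit. -/
def ptraceFst (M : Op) : Matrix (Fin 2) (Fin 2) ℂ :=
  ∑ i, M.submatrix (fun j => (i, j)) (fun j => (i, j))

theorem trace_kronecker_one_conj (E : Matrix (Fin 2) (Fin 2) ℂ) (M : Op) :
    ((E ⊗ₖ 1) * M * (E ⊗ₖ 1)ᴴ).trace = (E * ptraceSnd M * Eᴴ).trace := by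
  rw [trace, trace_fin_two, sum_idx]
  simp [mul_apply, Fin.sum_univ_two, sum_idx, ptraceSnd, one_apply]
  ring

theorem trace_one_kronecker_conj (E : Matrix (Fin 2) (Fin 2) ℂ) (M : Op) :
    (((1 : Matrix (Fin 2) (Fin 2) ℂ) ⊗ₖ E) * M * ((1 : Matrix (Fin 2) (Fin 2) ℂ) ⊗ₖ E)ᴴ).trace
      = (E * ptraceFst M * Eᴴ).trace := by
  rw [trace, trace_fin_two, sum_idx]
  simp [mul_apply, Fin.sum_univ_two, sum_idx, ptraceFst, one_apply]
  ring

/-- In the Pauli expansion `M ↦ flip * Mᵀ * flip` negates the local terms `σᵢ ⊗ 1` and `1 ⊗ σⱼ` and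
fixes all others. Scalar marginals say exactly that the local terms vanish. -/
theorem flip_mul_transpose_mul_flip_of_marginals {M : Op}
    (h₁ : ptraceSnd M 0 0 = ptraceSnd M 1 1 ∧ ptraceSnd M 0 1 = 0 ∧ ptraceSnd M 1 0 = 0)
    (h₂ : ptraceFst M 0 0 = ptraceFst M 1 1 ∧ ptraceFst M 0 1 = 0 ∧ ptraceFst M 1 0 = 0) :
    flip * Mᵀ * flip = M := by
  simp only [ptraceSnd, ptraceFst, Fin.sum_univ_two, Matrix.add_apply, submatrix_apply] at h₁ h₂
  obtain ⟨a1, a2, a3⟩ := h₁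
  obtain ⟨b1, b2, b3⟩ := h₂
  refine op_ext fun i j k l => ?_
  rw [mul_apply, sum_idx]
  simp only [mul_apply, sum_idx]
  fin_cases i <;> fin_cases j <;> fin_cases k <;> fin_cases l <;> simp [flip, pauli]
  · linear_combination (a1 + b1) / (-2)
  · linear_combination -b2
  · linear_combination -a2
  · linear_combination -b3
  · linear_combination (a1 - b1) / (-2)
  · linear_combination -a2
  · linear_combination -a3
  · linear_combination (a1 - b1) / 2
  · linear_combination -b2
  · linear_combination -a3
  · linear_combination -b3
  · linear_combination (a1 + b1) / 2

theorem flip_mul_transpose_mul_flip_local {U V : Matrix (Fin 2) (Fin 2) ℂ} (hU : U * Uᴴ = 1)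
    (hV : V * Vᴴ = 1) {M : Op} (hM : flip * Mᵀ * flip = M) :
    flip * ((U ⊗ₖ V) * M * (U ⊗ₖ V)ᴴ)ᵀ * flip = (U ⊗ₖ V) * M * (U ⊗ₖ V)ᴴ := by
  have hW := kronecker_transpose_mul_flip_mul U V
  have hz : star (U.det * V.det) * (U.det * V.det) = 1 := by
    rw [mul_comm, star_mul', mul_mul_mul_comm, det_mul_star_det_of_unitary hU,
      det_mul_star_det_of_unitary hV, one_mul]
  have hWW := kronecker_mul_conjTranspose hU hV
  have hW' := conjTranspose_mul_flip_mul hW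
  generalize U ⊗ₖ V = W at *
  generalize U.det * V.det = z at *
  have h1 : flip * Wᴴᵀ = W * (star z • flip) := by
    rw [← hW', ← Matrix.mul_assoc, ← Matrix.mul_assoc, hWW, Matrix.one_mul]
  have h2 : Wᵀ * flip = z • flip * Wᴴ := by
    rw [← hW, Matrix.mul_assoc, hWW, Matrix.mul_one]
  calc flip * (W * M * Wᴴ)ᵀ * flip = (flip * Wᴴᵀ) * Mᵀ * (Wᵀ * flip) := by
        simp only [transpose_mul, Matrix.mul_assoc]
    _ = W * (flip * Mᵀ * flip) * Wᴴ := by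
        rw [h1, h2]
        simp only [Matrix.mul_smul, Matrix.smul_mul, smul_smul, hz, one_smul, Matrix.mul_assoc,
          mul_comm z]
    _ = W * M * Wᴴ := by rw [hM]

/-! ### The lower bound for every state -/

/-- Singular value decomposition: determinant one makes the singular values `p` and `p⁻¹`, and all
phases go into `V`. -/
theorem exists_eq_unitary_mul_filt_mul_unitary {F : Matrix (Fin 2) (Fin 2) ℂ} (hF : F.det = 1) :
    ∃ (U V : Matrix (Fin 2) (Fin 2) ℂ) (p : ℝ), 0 < p ∧ U * Uᴴ = 1 ∧ V * Vᴴ = 1 ∧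
      F = U * filt p * V := by
  obtain ⟨U, l, hU, hl⟩ := exists_spectral_decomposition (isHermitian_mul_conjTranspose_self F)
  have hU' : Uᴴ * U = 1 := mul_eq_one_comm.1 hU
  have hd : (Uᴴ * F) * (Uᴴ * F)ᴴ = diagonal fun k => (l k : ℂ) := by
    rw [conjTranspose_mul, conjTranspose_conjTranspose, Matrix.mul_assoc, ← Matrix.mul_assoc F, hl]
    simp only [Matrix.mul_assoc, hU', Matrix.mul_one]
    rw [← Matrix.mul_assoc, hU', Matrix.one_mul]
    rfl
  have hl0 : ∀ k, 0 ≤ l k := by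
    intro k
    have := (posSemidef_self_mul_conjTranspose (Uᴴ * F)).diag_nonneg (i := k)
    rw [hd, diagonal_apply_eq] at this
    exact_mod_cast this
  have hprod : l 0 * l 1 = 1 := by
    have h := congrArg det hl
    rw [det_mul, det_mul, det_mul, det_conjTranspose, det_conjTranspose, hF, star_one, one_mul,
      det_diagonal, Fin.prod_univ_two, mul_right_comm, det_mul_star_det_of_unitary hU,
      one_mul] at h
    have h' : ((l 0 * l 1 : ℝ) : ℂ) = 1 := by
      rw [Complex.ofReal_mul]
      exact h.symm
    exact_mod_cast h'
  have hl0pos : 0 < l 0 := by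
    refine lt_of_le_of_ne (hl0 0) fun h => ?_
    rw [← h, zero_mul] at hprod
    exact zero_ne_one hprod
  set p := √(l 0)
  have hp : 0 < p := Real.sqrt_pos.2 hl0pos
  have hpc : (p : ℂ) ≠ 0 := by exact_mod_cast hp.ne'
  have hp2 : p ^ 2 = l 0 := Real.sq_sqrt hl0pos.le
  have hl1 : l 1 = (p ^ 2)⁻¹ := by rw [hp2]; exact eq_inv_of_mul_eq_one_right hprod
  have hff : filt p * filt p⁻¹ = 1 := by
    ext i j
    fin_cases i <;> fin_cases j <;> simp [filt, mul_apply, Fin.sum_univ_two, hpc]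
  refine ⟨U, filt p⁻¹ * (Uᴴ * F), p, hp, hU, ?_, ?_⟩
  · rw [conjTranspose_mul, Matrix.mul_assoc, ← Matrix.mul_assoc (Uᴴ * F), hd]
    ext i j
    fin_cases i <;> fin_cases j <;>
      simp [filt, mul_apply, Fin.sum_univ_two, hl1, ← hp2] <;> field_simp
  · rw [Matrix.mul_assoc, ← Matrix.mul_assoc (filt p), hff, Matrix.one_mul, ← Matrix.mul_assoc, hU,
      Matrix.one_mul]

theorem exists_charpoly_and_le_maxCHSH {ρ₀ : Op} (hρ : ρ₀.PosSemidef) {ε : ℝ} (hε : 0 < ε) :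
    ∃ m : Idx → ℝ, (∀ k, 0 ≤ m k) ∧
      (spinFlipProduct (ρ₀ + (ε : ℂ) • 1)).charpoly = ∏ k, (X - C (((m k ^ 2 : ℝ) : ℂ))) ∧
      ∀ k₀, √2 * (2 * m k₀ - ∑ k, m k) ≤ maxCHSH (ρ₀ + (ε : ℂ) • 1) := by
  obtain ⟨A, B, hA, hB, hmin⟩ := exists_min_filteredTrace hρ hε
  set ρ : Op := ρ₀ + (ε : ℂ) • 1 with hρdef
  have hεc : (0 : ℂ) ≤ (ε : ℂ) := by exact_mod_cast hε.le
  have hρp : ρ.PosSemidef := hρ.add (PosSemidef.one.smul hεc)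
  set M : Op := (A ⊗ₖ B) * ρ * (A ⊗ₖ B)ᴴ with hM
  have hMp : M.PosSemidef := hρp.mul_mul_conjTranspose_same _
  have hsnd : (ptraceSnd M).PosSemidef :=
    posSemidef_sum _ fun j _ => hMp.submatrix _
  have hfst : (ptraceFst M).PosSemidef :=
    posSemidef_sum _ fun j _ => hMp.submatrix _
  -- Filtering the minimizer further on one side stays inside `SL₂ × SL₂`, so the corresponding
  -- marginal has minimal trace on its own orbit.
  have h₁ := eq_scalar_of_trace_minimal hsnd fun E hE => by
    have h := hmin (E * A) (1 * B) (by rw [det_mul, hE, hA, one_mul]) (by rwa [Matrix.one_mul])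
    rw [filteredTrace_mul, trace_kronecker_one_conj] at h
    have e := trace_kronecker_one_conj 1 M
    simp only [one_kronecker_one, Matrix.one_mul, conjTranspose_one, Matrix.mul_one] at e
    rwa [← e]
  have h₂ := eq_scalar_of_trace_minimal hfst fun E hE => by
    have h := hmin (1 * A) (E * B) (by rwa [Matrix.one_mul]) (by rw [det_mul, hE, hB, one_mul])
    rw [filteredTrace_mul, trace_one_kronecker_conj] at h
    have e := trace_one_kronecker_conj 1 M
    simp only [one_kronecker_one, Matrix.one_mul, conjTranspose_one, Matrix.mul_one] at e
    rwa [← e]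
  have hflip := flip_mul_transpose_mul_flip_of_marginals h₁ h₂
  have hAi : (A⁻¹).det = 1 := by rw [det_nonsing_inv, hA, Ring.inverse_one]
  have hBi : (B⁻¹).det = 1 := by rw [det_nonsing_inv, hB, Ring.inverse_one]
  obtain ⟨U, V, p, hp, hU, hV, hUV⟩ := exists_eq_unitary_mul_filt_mul_unitary hAi
  obtain ⟨U', V', q, hq, hU', hV', hUV'⟩ := exists_eq_unitary_mul_filt_mul_unitary hBi
  -- The inner unitaries of the inverse filters are absorbed into `M`, which stays spin-flip
  -- invariant; the outer ones do not affect the CHSH value.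
  set M' : Op := (V ⊗ₖ V') * M * (V ⊗ₖ V')ᴴ with hM'
  have hM'p : M'.PosSemidef := hMp.mul_mul_conjTranspose_same _
  have hflip' : flip * M'ᵀ * flip = M' := flip_mul_transpose_mul_flip_local hV hV' hflip
  have hAA : A⁻¹ * A = 1 := nonsing_inv_mul A (by rw [hA]; exact isUnit_one)
  have hBB : B⁻¹ * B = 1 := nonsing_inv_mul B (by rw [hB]; exact isUnit_one)
  have hρM : ρ = (U ⊗ₖ U') * ((filt p ⊗ₖ filt q) * M' * (filt p ⊗ₖ filt q)ᴴ) * (U ⊗ₖ U')ᴴ := by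
    have h1 : (A⁻¹ ⊗ₖ B⁻¹) * (A ⊗ₖ B) = 1 := by
      rw [← mul_kronecker_mul, hAA, hBB, one_kronecker_one]
    have h2 : A⁻¹ ⊗ₖ B⁻¹ = (U ⊗ₖ U') * (filt p ⊗ₖ filt q) * (V ⊗ₖ V') := by
      rw [← mul_kronecker_mul, ← mul_kronecker_mul, ← hUV, ← hUV']
    have h3 : ρ = (A⁻¹ ⊗ₖ B⁻¹) * M * (A⁻¹ ⊗ₖ B⁻¹)ᴴ := by
      have h4 : (A ⊗ₖ B)ᴴ * (A⁻¹ ⊗ₖ B⁻¹)ᴴ = 1 := by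
        rw [← conjTranspose_mul, h1, conjTranspose_one]
      rw [hM]
      simp only [Matrix.mul_assoc, h4, Matrix.mul_one]
      rw [← Matrix.mul_assoc, h1, Matrix.one_mul]
    rw [h3, h2, hM']
    simp only [conjTranspose_mul, Matrix.mul_assoc]
  obtain ⟨G, m, hm, hG, hGf, hGM⟩ := exists_flip_real_decomposition hM'p hflip'
  refine ⟨m, hm, ?_, fun k₀ => ?_⟩
  · rw [hρM, charpoly_spinFlipProduct_local hU hU',
      charpoly_spinFlipProduct_conj (kronecker_transpose_mul_flip_mul _ _)]
    · exact charpoly_spinFlipProduct_of_flip_real hflip' hG hGM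
    · have hd : ∀ t : ℝ, 0 < t → (filt t).det = 1 := by
        intro t ht
        simp [filt, det_fin_two, ht.ne']
      rw [hd p hp, hd q hq]
      simp
  · rw [hρM, maxCHSH_local hU hU']
    exact sqrt_two_mul_le_maxCHSH_of_filt hm hG hGf hGM hp hq k₀

/-- Bell operators are traceless, so the regularization is invisible to the CHSH value and no
continuity of `maxCHSH` is needed in the limit. -/
theorem maxCHSH_add_smul_one (ρ : Op) (z : ℂ) : maxCHSH (ρ + z • 1) = maxCHSH ρ := by
  have h : ∀ a b c d, (bellOp a b c d).trace = 0 := by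
    intro a b c d
    rw [bellOp_eq, trace_smul, trace_add, trace_kronecker, trace_kronecker]
    simp [sig, trace_fin_two]
  rw [maxCHSH, maxCHSH, bellValues, bellValues]
  simp only [Matrix.add_mul, Matrix.smul_mul, Matrix.one_mul, trace_add, trace_smul, h, smul_zero,
    add_zero]

open Filter Topology in
theorem exists_charpoly_and_le_maxCHSH' {ρ : Op} (hρ : ρ.PosSemidef) :
    ∃ m : Idx → ℝ, (∀ k, 0 ≤ m k) ∧
      (spinFlipProduct ρ).charpoly = ∏ k, (X - C (((m k ^ 2 : ℝ) : ℂ))) ∧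
      ∀ k₀, √2 * (2 * m k₀ - ∑ k, m k) ≤ maxCHSH ρ := by
  have hε : ∀ n : ℕ, (0 : ℝ) < 1 / ((n : ℝ) + 1) := fun n => by positivity
  choose m hm hchar hle using fun n : ℕ => exists_charpoly_and_le_maxCHSH hρ (hε n)
  set σ : ℕ → Op := fun n => ρ + ((1 / ((n : ℝ) + 1) : ℝ) : ℂ) • 1 with hσ
  have hσlim : Tendsto σ atTop (𝓝 ρ) := by
    have h1 : Tendsto (fun n : ℕ => ((1 / ((n : ℝ) + 1) : ℝ) : ℂ)) atTop (𝓝 ((0 : ℝ) : ℂ)) :=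
      (Complex.continuous_ofReal.tendsto 0).comp tendsto_one_div_add_atTop_nhds_zero_nat
    have h2 := (tendsto_const_nhds (x := ρ)).add (h1.smul_const (1 : Op))
    simpa [hσ] using h2
  have hcont : Continuous spinFlipProduct := by
    unfold spinFlipProduct
    exact ((continuous_id.matrix_mul continuous_const).matrix_mul
      continuous_id.matrix_transpose).matrix_mul continuous_const
  have hlim : Tendsto (fun n => spinFlipProduct (σ n)) atTop (𝓝 (spinFlipProduct ρ)) :=
    (hcont.tendsto ρ).comp hσlim
  have htrace : ∀ n, (spinFlipProduct (σ n)).trace = ((∑ k, m n k ^ 2 : ℝ) : ℂ) := by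
    intro n
    have h' : ∏ k, (X - C (((m n k ^ 2 : ℝ) : ℂ)))
        = ((Finset.univ.val.map fun k => ((m n k ^ 2 : ℝ) : ℂ)).map fun a => X - C a).prod := by
      rw [Multiset.map_map]
      rfl
    rw [trace_eq_sum_roots_charpoly, hchar n, h', roots_multiset_prod_X_sub_C, Complex.ofReal_sum]
    rfl
  -- The sum of the `m n k ^ 2` is the trace of a convergent sequence, so the `m n` lie in a compact
  -- cube.
  have hbdd : ∃ R, ∀ n k, m n k ≤ R := by
    have h1 : Tendsto (fun n => (spinFlipProduct (σ n)).trace.re) atTop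
        (𝓝 (spinFlipProduct ρ).trace.re) :=
      ((Complex.continuous_re.comp continuous_id.matrix_trace).tendsto _).comp hlim
    obtain ⟨R, hR⟩ := h1.bddAbove_range
    refine ⟨R + 1, fun n k => ?_⟩
    have h2 := hR ⟨n, rfl⟩
    simp only [htrace, Complex.ofReal_re] at h2
    have h3 : m n k ^ 2 ≤ ∑ k, m n k ^ 2 :=
      Finset.single_le_sum (f := fun k => m n k ^ 2) (fun k _ => sq_nonneg _) (Finset.mem_univ k)
    nlinarith [sq_nonneg (m n k - 1)]
  obtain ⟨R, hR⟩ := hbdd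
  have hcompact : IsCompact (Set.univ.pi fun _ : Idx => Set.Icc 0 R) :=
    isCompact_univ_pi fun _ => isCompact_Icc
  obtain ⟨a, ha, φ, hφ, hφlim⟩ := hcompact.tendsto_subseq
    (x := m) fun n k _ => ⟨hm n k, hR n k⟩
  refine ⟨a, fun k => (ha k trivial).1, ?_, fun k₀ => ?_⟩
  · refine Polynomial.funext fun x => ?_
    have h1 : Tendsto (fun n => (spinFlipProduct (σ (φ n))).charpoly.eval x) atTop
        (𝓝 ((spinFlipProduct ρ).charpoly.eval x)) := by
      simp only [eval_charpoly]
      have hc : Continuous fun A : Op => (scalar Idx x - A).det := by fun_prop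
      exact (hc.tendsto _).comp (hlim.comp hφ.tendsto_atTop)
    have h2 : Tendsto (fun n => (spinFlipProduct (σ (φ n))).charpoly.eval x) atTop
        (𝓝 ((∏ k, (X - C (((a k ^ 2 : ℝ) : ℂ)))).eval x)) := by
      simp only [hσ, hchar, eval_prod, eval_sub, eval_X, eval_C]
      have hc : Continuous fun b : Idx → ℝ => ∏ k, (x - ((b k ^ 2 : ℝ) : ℂ)) := by fun_prop
      exact (hc.tendsto _).comp hφlim
    exact tendsto_nhds_unique h1 h2
  · have hc : Continuous fun b : Idx → ℝ => √2 * (2 * b k₀ - ∑ k, b k) := by fun_prop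
    refine le_of_tendsto' ((hc.tendsto _).comp hφlim) fun n => ?_
    have := hle (φ n) k₀
    rwa [maxCHSH_add_smul_one] at this

theorem sqrt_two_mul_concurrence_le_maxCHSH {ρ : Op} (hρ : ρ.PosSemidef) :
    √2 * concurrence ρ ≤ maxCHSH ρ := by
  obtain ⟨m, hm, hchar, hle⟩ := exists_charpoly_and_le_maxCHSH' hρ
  obtain ⟨k₀, hk₀⟩ := Finite.exists_max m
  rw [concurrence_eq_of_charpoly hm hchar hk₀]
  rcases le_total (2 * m k₀ - ∑ k, m k) 0 with h | h
  · rw [max_eq_left h, mul_zero]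
    exact maxCHSH_nonneg ρ
  · rw [max_eq_right h]
    exact hle k₀

/-! ### A family of extremal states -/

/-- The unitary matrix with columns `|00⟩`, `(|01⟩ + |10⟩)/√2`, `(|01⟩ - |10⟩)/√2`, `|11⟩`. -/
def bellFrame : Op := fun i j =>
  ![![![![1, 0], ![0, 0]], ![![0, ((√2 / 2 : ℝ) : ℂ)], ![((√2 / 2 : ℝ) : ℂ), 0]]],
    ![![![0, ((√2 / 2 : ℝ) : ℂ)], ![-((√2 / 2 : ℝ) : ℂ), 0]], ![![0, 0], ![0, 1]]]] i.1 i.2 j.1 j.2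

/-- Weights of a rank-deficient spectrum, with the smallest one at the index `(1, 1)`. -/
def weights (l₁ l₂ l₃ : ℝ) : Idx → ℝ := fun k => ![![l₂, l₁], ![l₃, 0]] k.1 k.2

/-- The state `l₁ |ψ₊⟩⟨ψ₊| + l₂ |00⟩⟨00| + l₃ |ψ₋⟩⟨ψ₋|` with `ψ± = (|01⟩ ± |10⟩)/√2`. -/
def famState (l₁ l₂ l₃ : ℝ) : Op :=
  bellFrame * diagonal (fun k => (weights l₁ l₂ l₃ k : ℂ)) * bellFrameᴴ

theorem half_sqrt_two_mul_self : ((√2 / 2 : ℝ) : ℂ) * ((√2 / 2 : ℝ) : ℂ) = 1 / 2 := by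
  have h : (√2 / 2) * (√2 / 2) = 1 / 2 := by
    have := Real.mul_self_sqrt (by norm_num : (0 : ℝ) ≤ 2)
    linarith
  rw [← Complex.ofReal_mul, h]
  norm_num

theorem bellFrame_mul_conjTranspose : bellFrame * bellFrameᴴ = 1 := by
  have h := half_sqrt_two_mul_self
  refine op_ext fun i j k l => ?_
  rw [mul_apply, sum_idx]
  simp only [bellFrame, conjTranspose_apply]
  generalize hs : ((√2 / 2 : ℝ) : ℂ) = s at *
  have hr : (starRingEnd ℂ) s = s := by rw [← hs]; exact Complex.conj_ofReal _
  fin_cases i <;> fin_cases j <;> fin_cases k <;> fin_cases l <;> simp [hr, h] <;> norm_num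

theorem famState_eq (l₁ l₂ l₃ : ℝ) : famState l₁ l₂ l₃ = Matrix.of fun i j : Idx =>
    ![![![![(l₂ : ℂ), 0], ![0, 0]], ![![0, ((l₁ : ℂ) + l₃) / 2], ![((l₁ : ℂ) - l₃) / 2, 0]]],
      ![![![0, ((l₁ : ℂ) - l₃) / 2], ![((l₁ : ℂ) + l₃) / 2, 0]], ![![0, 0], ![0, 0]]]]
      i.1 i.2 j.1 j.2 := by
  have h := half_sqrt_two_mul_self
  refine op_ext fun i j k l => ?_
  rw [famState, mul_apply, sum_idx]
  simp only [mul_diagonal, bellFrame, conjTranspose_apply, weights, of_apply]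
  generalize hs : ((√2 / 2 : ℝ) : ℂ) = s at *
  have hr : (starRingEnd ℂ) s = s := by rw [← hs]; exact Complex.conj_ofReal _
  fin_cases i <;> fin_cases j <;> fin_cases k <;> fin_cases l <;> simp [hr]
  · linear_combination ((l₁ : ℂ) + l₃) * h
  · linear_combination ((l₁ : ℂ) - l₃) * h
  · linear_combination ((l₁ : ℂ) - l₃) * h
  · linear_combination ((l₁ : ℂ) + l₃) * h

theorem famState_isState {l₁ l₂ l₃ : ℝ} (h₁ : 0 ≤ l₁) (h₂ : 0 ≤ l₂) (h₃ : 0 ≤ l₃)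
    (hsum : l₁ + l₂ + l₃ = 1) : IsState (famState l₁ l₂ l₃) := by
  constructor
  · refine (PosSemidef.diagonal fun k => ?_).mul_mul_conjTranspose_same _
    obtain ⟨i, j⟩ := k
    fin_cases i <;> fin_cases j <;> simp [weights, h₁, h₂, h₃]
  · rw [famState_eq, trace, sum_idx]
    simp
    have : (l₁ : ℂ) + l₂ + l₃ = 1 := by exact_mod_cast hsum
    linear_combination this

theorem rank_famState_lt (l₁ l₂ l₃ : ℝ) : (famState l₁ l₂ l₃).rank < 4 := by
  refine (rank_mul_le_left _ _).trans_lt ((rank_mul_le_right _ _).trans_lt ?_)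
  rw [rank_diagonal]
  exact (Fintype.card_subtype_lt (x := ((1, 1) : Idx)) (by simp [weights])).trans_eq (by simp)

theorem charpoly_spinFlipProduct_conj_diagonal (W : Op) (d : Idx → ℂ) :
    (spinFlipProduct (W * diagonal d * Wᴴ)).charpoly
      = (diagonal d * (Wᵀ * flip * W)ᴴ * diagonal d * (Wᵀ * flip * W)).charpoly := by
  have e : spinFlipProduct (W * diagonal d * Wᴴ)
      = W * (diagonal d * (Wᵀ * flip * W)ᴴ * diagonal d * (Wᵀ * flip)) := by
    have h1 : (Wᵀ)ᴴ = (Wᴴ)ᵀ := rfl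
    simp only [spinFlipProduct, transpose_mul, diagonal_transpose, conjTranspose_mul,
      flip_conjTranspose, Matrix.mul_assoc, h1]
  rw [e, charpoly_mul_comm]
  simp only [Matrix.mul_assoc]

theorem concurrence_famState {l₁ l₂ l₃ : ℝ} (h₃ : 0 ≤ l₃) (h : l₃ ≤ l₁) :
    concurrence (famState l₁ l₂ l₃) = l₁ - l₃ := by
  -- The spin flip fixes `ψ₊` and `ψ₋` up to sign and exchanges `|00⟩` with `|11⟩`. The latter has
  -- weight `0`, so `l₂` drops out of the spin-flip spectrum.
  have hK : bellFrameᵀ * flip * bellFrame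
      = Matrix.of fun i j : Idx => ![![![![0, 0], ![0, -1]], ![![0, 1], ![0, 0]]],
        ![![![0, 0], ![-1, 0]], ![![-1, 0], ![0, (0 : ℂ)]]]] i.1 i.2 j.1 j.2 := by
    have hh := half_sqrt_two_mul_self
    refine op_ext fun i j k l => ?_
    rw [mul_apply, sum_idx]
    simp only [mul_apply, sum_idx, bellFrame, transpose_apply, of_apply]
    generalize ((√2 / 2 : ℝ) : ℂ) = s at *
    fin_cases i <;> fin_cases j <;> fin_cases k <;> fin_cases l <;> simp [flip, pauli, hh] <;>
      norm_num
  have hchar : (spinFlipProduct (famState l₁ l₂ l₃)).charpoly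
      = ∏ k, (X - C (((weights l₁ 0 l₃ k ^ 2 : ℝ) : ℂ))) := by
    rw [famState, charpoly_spinFlipProduct_conj_diagonal, hK, ← charpoly_diagonal]
    congr 1
    refine op_ext fun i j k l => ?_
    rw [mul_apply, sum_idx]
    simp only [mul_diagonal]
    simp only [diagonal_mul, conjTranspose_apply, of_apply]
    fin_cases i <;> fin_cases j <;> fin_cases k <;> fin_cases l <;> simp [weights] <;> ring
  have h₁ : 0 ≤ l₁ := h₃.trans h
  rw [concurrence_eq_of_charpoly (k₀ := (0, 1)) _ hchar]
  · rw [sum_idx]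
    simp only [weights]
    simp only [cons_val_zero, cons_val_one]
    rw [max_eq_right (by linarith)]
    ring
  · rintro ⟨i, j⟩
    fin_cases i <;> fin_cases j <;> simp [weights, h₁, h]
  · rintro ⟨i, j⟩
    fin_cases i <;> fin_cases j <;> simp [weights, h₁, h₃]

theorem re_trace_famState_mul_bellOp (l₁ l₂ l₃ : ℝ) (a b c d : Dir) :
    ((famState l₁ l₂ l₃ * bellOp a b c d).trace).re
      = ((l₁ - l₃) * ((a 0 * (c 0 + d 0) + b 0 * (c 0 - d 0))
        + (a 1 * (c 1 + d 1) + b 1 * (c 1 - d 1)))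
        + (l₂ - l₁ - l₃) * (a 2 * (c 2 + d 2) + b 2 * (c 2 - d 2))) / 2 := by
  rw [famState_eq, bellOp_eq, trace]
  simp only [sum_idx, diag_apply, mul_apply, Matrix.smul_apply, Matrix.add_apply,
    kroneckerMap_apply, Matrix.sub_apply, sig, smul_eq_mul, of_apply]
  simp
  ring

theorem maxCHSH_le_of_forall {ρ : Op} {t : ℝ} (h : ∀ a b c d : Dir, ‖a‖ = 1 → ‖b‖ = 1 →
    ‖c‖ = 1 → ‖d‖ = 1 → ((ρ * bellOp a b c d).trace).re ≤ t) : maxCHSH ρ ≤ t := by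
  obtain ⟨a, b, c, d, ha, hb, hc, hd, e⟩ := (isGreatest_maxCHSH ρ).1
  rw [e]
  exact h a b c d ha hb hc hd

theorem maxCHSH_famState_le_sqrt_two_mul {l₁ l₂ l₃ : ℝ} (h : |l₂ - l₁ - l₃| ≤ l₁ - l₃) :
    maxCHSH (famState l₁ l₂ l₃) ≤ √2 * (l₁ - l₃) := by
  refine maxCHSH_le_of_forall fun a b c d ha hb hc hd => ?_
  rw [re_trace_famState_mul_bellOp]
  have ha' := norm_dir_sq a
  have hb' := norm_dir_sq b
  have hc' := norm_dir_sq c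
  have hd' := norm_dir_sq d
  rw [ha, one_pow] at ha'
  rw [hb, one_pow] at hb'
  rw [hc, one_pow] at hc'
  rw [hd, one_pow] at hd'
  generalize l₁ - l₃ = t at *
  generalize l₂ - l₁ - l₃ = z at *
  have ht : 0 ≤ t := (abs_nonneg z).trans h
  have h2 : √2 * √2 = 2 := Real.mul_self_sqrt (by norm_num)
  have hs : 0 < √2 := by positivity
  -- The weights give equality at `u = ±√2 x`, the optimal CHSH configuration: for `a` orthogonal to
  -- `b` the vectors `a ± b` have length `√2`.
  have amgm : ∀ u x : ℝ, |u * x| ≤ √2 / 4 * u ^ 2 + √2 / 2 * x ^ 2 := by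
    intro u x
    rw [abs_le]
    constructor
    · nlinarith [mul_nonneg hs.le (sq_nonneg (u + √2 * x))]
    · nlinarith [mul_nonneg hs.le (sq_nonneg (u - √2 * x))]
  have bound : ∀ r : ℝ, |r| ≤ t → ∀ a b c d : ℝ, r * (a * (c + d) + b * (c - d))
      ≤ t * (√2 / 4 * (2 * a ^ 2 + 2 * b ^ 2) + √2 / 2 * (c ^ 2 + d ^ 2)) := by
    intro r hr a b c d
    have e : a * (c + d) + b * (c - d) = (a + b) * c + (a - b) * d := by ring
    have h3 := (abs_add_le _ _).trans (add_le_add (amgm (a + b) c) (amgm (a - b) d))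
    rw [e]
    refine (le_abs_self _).trans ?_
    rw [abs_mul]
    refine mul_le_mul hr (h3.trans_eq (by ring)) (abs_nonneg _) ht
  have k0 := bound t (abs_of_nonneg ht).le (a 0) (b 0) (c 0) (d 0)
  have k1 := bound t (abs_of_nonneg ht).le (a 1) (b 1) (c 1) (d 1)
  have k2 := bound z h (a 2) (b 2) (c 2) (d 2)
  have e : t * (√2 / 4 * (2 * a 0 ^ 2 + 2 * b 0 ^ 2) + √2 / 2 * (c 0 ^ 2 + d 0 ^ 2))
      + t * (√2 / 4 * (2 * a 1 ^ 2 + 2 * b 1 ^ 2) + √2 / 2 * (c 1 ^ 2 + d 1 ^ 2))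
      + t * (√2 / 4 * (2 * a 2 ^ 2 + 2 * b 2 ^ 2) + √2 / 2 * (c 2 ^ 2 + d 2 ^ 2))
      = 2 * (√2 * t) := by
    linear_combination (-(t * √2 / 2)) * (ha' + hb' + hc' + hd')
  linarith

/-- Cauchy–Schwarz: the hypothesis bounds the Frobenius norm of the correlation matrix by `1`, and
the coefficient matrix of `2𝓑` has Frobenius norm `2`, because `c + d` and `c - d` are orthogonal.
-/
theorem maxCHSH_famState_le_one {l₁ l₂ l₃ : ℝ}
    (h : 2 * (l₁ - l₃) ^ 2 + (l₂ - l₁ - l₃) ^ 2 ≤ 1) : maxCHSH (famState l₁ l₂ l₃) ≤ 1 := by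
  refine maxCHSH_le_of_forall fun a b c d ha hb hc hd => ?_
  rw [re_trace_famState_mul_bellOp]
  have hP : ‖c + d‖ ^ 2 + ‖c - d‖ ^ 2 = 4 := by
    have := parallelogram_law_with_norm ℝ c d
    rw [hc, hd] at this
    linarith
  rw [norm_dir_sq, norm_dir_sq] at hP
  simp only [PiLp.add_apply, PiLp.sub_apply] at hP
  have ha' := norm_dir_sq a
  have hb' := norm_dir_sq b
  have hc' := norm_dir_sq c
  have hd' := norm_dir_sq d
  rw [ha, one_pow] at ha'
  rw [hb, one_pow] at hb'
  rw [hc, one_pow] at hc'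
  rw [hd, one_pow] at hd'
  generalize l₁ - l₃ = t at *
  generalize l₂ - l₁ - l₃ = z at *
  have hfrob : ∑ i, ∑ j, (a i * (c j + d j) + b i * (c j - d j)) ^ 2 = 4 := by
    simp only [Fin.sum_univ_three]
    linear_combination
      (-((c 0 + d 0) ^ 2 + (c 1 + d 1) ^ 2 + (c 2 + d 2) ^ 2)) * ha'
      - ((c 0 - d 0) ^ 2 + (c 1 - d 1) ^ 2 + (c 2 - d 2) ^ 2) * hb' + hP
      - 2 * (a 0 * b 0 + a 1 * b 1 + a 2 * b 2) * (hc' - hd')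
  have hdiag : ∑ i, (a i * (c i + d i) + b i * (c i - d i)) ^ 2 ≤ 4 := by
    rw [← hfrob]
    exact Finset.sum_le_sum fun i _ => Finset.single_le_sum
      (f := fun j => (a i * (c j + d j) + b i * (c j - d j)) ^ 2) (fun j _ => sq_nonneg _)
      (Finset.mem_univ i)
  rw [Fin.sum_univ_three] at hdiag
  generalize a 0 * (c 0 + d 0) + b 0 * (c 0 - d 0) = k0 at *
  generalize a 1 * (c 1 + d 1) + b 1 * (c 1 - d 1) = k1 at *
  generalize a 2 * (c 2 + d 2) + b 2 * (c 2 - d 2) = k2 at *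
  nlinarith [sq_nonneg (k0 - 2 * t), sq_nonneg (k1 - 2 * t), sq_nonneg (k2 - 2 * z)]

/-! ### The largest concurrence for a rank-deficient spectrum -/

/-- The squared Hermitian norm of a vector. -/
def nsq (x : Vec) : ℝ := ∑ i, ‖x i‖ ^ 2

theorem coe_nsq (x : Vec) : (nsq x : ℂ) = star x ⬝ᵥ x := by
  rw [nsq, dotProduct, Complex.ofReal_sum]
  refine Finset.sum_congr rfl fun i _ => ?_
  rw [Complex.ofReal_pow]
  exact (Complex.conj_mul' _).symm

theorem nsq_nonneg (x : Vec) : 0 ≤ nsq x := Finset.sum_nonneg fun _ _ => by positivity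

theorem nsq_pos {x : Vec} (hx : x ≠ 0) : 0 < nsq x := by
  obtain ⟨i, hi⟩ := Function.ne_iff.1 hx
  refine Finset.sum_pos' (fun _ _ => by positivity) ⟨i, Finset.mem_univ i, ?_⟩
  have : x i ≠ 0 := hi
  positivity

theorem coe_nsq_mulVec (A : Op) (x : Vec) :
    (nsq (A *ᵥ x) : ℂ) = star x ⬝ᵥ ((Aᴴ * A) *ᵥ x) := by
  rw [coe_nsq, star_mulVec, ← dotProduct_mulVec, mulVec_mulVec]

theorem nsq_mulVec_of_unitary {V : Op} (hV : Vᴴ * V = 1) (x : Vec) : nsq (V *ᵥ x) = nsq x := by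
  have h := coe_nsq_mulVec V x
  rw [hV, one_mulVec, ← coe_nsq] at h
  exact_mod_cast h

theorem nsq_diagonal_mulVec {d : Idx → ℝ} (hd : ∀ k, 0 ≤ d k) (x : Vec) :
    nsq (diagonal (fun k => ((√(d k) : ℝ) : ℂ)) *ᵥ x) = ∑ k, d k * ‖x k‖ ^ 2 := by
  refine Finset.sum_congr rfl fun k _ => ?_
  rw [mulVec_diagonal, norm_mul, mul_pow, Complex.norm_real, Real.norm_of_nonneg
    (Real.sqrt_nonneg _), Real.sq_sqrt (hd k)]

theorem nsq_mulVec_eq_sum {A U : Op} {μ : Idx → ℝ}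
    (h : Aᴴ * A = U * diagonal (fun k => (μ k : ℂ)) * Uᴴ) (x : Vec) :
    nsq (A *ᵥ x) = ∑ k, μ k * ‖(Uᴴ *ᵥ x) k‖ ^ 2 := by
  have h1 := coe_nsq_mulVec A x
  rw [h, ← mulVec_mulVec, ← mulVec_mulVec, dotProduct_mulVec] at h1
  have e : star x ᵥ* U = star (Uᴴ *ᵥ x) := by rw [star_mulVec, conjTranspose_conjTranspose]
  rw [e, dotProduct] at h1
  have h2 : (nsq (A *ᵥ x) : ℂ) = ((∑ k, μ k * ‖(Uᴴ *ᵥ x) k‖ ^ 2 : ℝ) : ℂ) := by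
    rw [h1, Complex.ofReal_sum]
    refine Finset.sum_congr rfl fun k _ => ?_
    have e2 : star ((Uᴴ *ᵥ x) k) * (Uᴴ *ᵥ x) k = (‖(Uᴴ *ᵥ x) k‖ : ℂ) ^ 2 := Complex.conj_mul' _
    rw [mulVec_diagonal, Pi.star_apply, mul_left_comm, e2]
    push_cast
    rfl
  exact_mod_cast h2

theorem exists_ne_zero_of_three_equations (r₁ r₂ r₃ : Vec) :
    ∃ x : Vec, x ≠ 0 ∧ r₁ ⬝ᵥ x = 0 ∧ r₂ ⬝ᵥ x = 0 ∧ r₃ ⬝ᵥ x = 0 := by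
  set T : Op := fun i => ![![r₁, r₂], ![r₃, 0]] i.1 i.2 with hT
  have hdet : T.det = 0 := det_eq_zero_of_row_eq_zero (1, 1) fun j => by simp [hT]
  obtain ⟨x, hx, hTx⟩ := exists_mulVec_eq_zero_iff.2 hdet
  exact ⟨x, hx, congrFun hTx (0, 0), congrFun hTx (0, 1), congrFun hTx (1, 0)⟩

/-- The concurrence of a state with spectrum `l₁ ≥ l₂ ≥ l₃ ≥ 0` is at most `l₁ - l₃`. -/
theorem concurrence_conj_diagonal_le {W : Op} (hW : W * Wᴴ = 1) {l₁ l₂ l₃ : ℝ} (h₁₂ : l₂ ≤ l₁)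
    (h₂₃ : l₃ ≤ l₂) (h₃ : 0 ≤ l₃) :
    concurrence (W * diagonal (fun k => (weights l₁ l₂ l₃ k : ℂ)) * Wᴴ) ≤ l₁ - l₃ := by
  have hl₂ : 0 ≤ l₂ := h₃.trans h₂₃
  have hl₁ : 0 ≤ l₁ := hl₂.trans h₁₂
  have hd0 : ∀ k, 0 ≤ weights l₁ l₂ l₃ k := by
    rintro ⟨i, j⟩
    fin_cases i <;> fin_cases j <;> simp [weights, hl₁, hl₂, h₃]
  have hd1 : ∀ k, weights l₁ l₂ l₃ k ≤ l₁ := by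
    rintro ⟨i, j⟩
    fin_cases i <;> fin_cases j <;> simp [weights, hl₁, h₁₂, h₂₃.trans h₁₂]
  have hd3 : ∀ k, k ≠ (1, 1) → l₃ ≤ weights l₁ l₂ l₃ k := by
    rintro ⟨i, j⟩ hk
    fin_cases i <;> fin_cases j <;> simp [weights, h₂₃, h₂₃.trans h₁₂] at hk ⊢
  have hlow : ∀ x : Vec, x (1, 1) = 0 →
      l₃ * nsq x ≤ ∑ k, weights l₁ l₂ l₃ k * ‖x k‖ ^ 2 := by
    intro x hx
    rw [nsq, Finset.mul_sum]
    refine Finset.sum_le_sum fun k _ => ?_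
    by_cases hk : k = (1, 1)
    · rw [hk, hx]; simp
    · exact mul_le_mul_of_nonneg_right (hd3 k hk) (by positivity)
  have hup : ∀ x : Vec, ∑ k, weights l₁ l₂ l₃ k * ‖x k‖ ^ 2 ≤ l₁ * nsq x := by
    intro x
    rw [nsq, Finset.mul_sum]
    exact Finset.sum_le_sum fun k _ => mul_le_mul_of_nonneg_right (hd1 k) (by positivity)
  set V : Op := Wᵀ * flip * W with hV
  have hVV : Vᴴ * V = 1 := by
    have h1 : (Wᵀ)ᴴ * Wᵀ = 1 := by
      have : (Wᵀ)ᴴ * Wᵀ = (W * Wᴴ)ᵀ := by rw [transpose_mul]; rfl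
      rw [this, hW, transpose_one]
    rw [hV, conjTranspose_mul, conjTranspose_mul, flip_conjTranspose]
    calc Wᴴ * (flip * (Wᵀ)ᴴ) * (Wᵀ * flip * W)
        = Wᴴ * (flip * ((Wᵀ)ᴴ * Wᵀ) * flip) * W := by simp only [Matrix.mul_assoc]
      _ = 1 := by
        rw [h1, Matrix.mul_one, flip_mul_flip, Matrix.mul_one, mul_eq_one_comm.1 hW]
  set E : Op := diagonal (fun k => ((√(weights l₁ l₂ l₃ k) : ℝ) : ℂ)) with hE
  have hEE : diagonal (fun k => (weights l₁ l₂ l₃ k : ℂ)) = E * E := by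
    rw [hE, diagonal_mul_diagonal]
    congr 1
    ext k
    rw [← Complex.ofReal_mul, Real.mul_self_sqrt (hd0 k)]
  have hEh : Eᴴ = E := by
    rw [hE, diagonal_conjTranspose]
    congr 1
    ext k
    exact Complex.conj_ofReal _
  have hEn : ∀ x, nsq (E *ᵥ x) = ∑ k, weights l₁ l₂ l₃ k * ‖x k‖ ^ 2 := nsq_diagonal_mulVec hd0
  clear_value V E
  -- The numbers `√lᵢ` are the singular values of `A`, where `V` is unitary and `E` is the square
  -- root of the weights. The largest is at most `‖E‖² = l₁`; it remains to see that a second one is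
  -- at least `l₃`.
  set A : Op := E * V * E with hA
  have hAx : ∀ x, A *ᵥ x = E *ᵥ (V *ᵥ (E *ᵥ x)) := by
    intro x
    rw [hA, ← mulVec_mulVec, ← mulVec_mulVec]
  have hchar : (spinFlipProduct (W * diagonal (fun k => (weights l₁ l₂ l₃ k : ℂ)) * Wᴴ)).charpoly
      = (Aᴴ * A).charpoly := by
    rw [charpoly_spinFlipProduct_conj_diagonal, ← hV, hEE]
    have e1 : E * E * Vᴴ * (E * E) * V = E * (E * Vᴴ * (E * E) * V) := by
      simp only [Matrix.mul_assoc]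
    rw [e1, charpoly_mul_comm, hA, conjTranspose_mul, conjTranspose_mul, hEh]
    simp only [Matrix.mul_assoc]
  obtain ⟨U, μ, hU, hUμ⟩ := exists_spectral_decomposition (isHermitian_conjTranspose_mul_self A)
  have hU' : Uᴴ * U = 1 := mul_eq_one_comm.1 hU
  have hUx : ∀ x, nsq (Uᴴ *ᵥ x) = nsq x :=
    nsq_mulVec_of_unitary (by rwa [conjTranspose_conjTranspose])
  have hsum := nsq_mulVec_eq_sum (μ := μ) hUμ
  have hμe : ∀ k, μ k = nsq (A *ᵥ (U *ᵥ Pi.single k 1)) := by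
    intro k
    rw [hsum, mulVec_mulVec, hU', one_mulVec, Finset.sum_eq_single k]
    · simp
    · intro j _ hj
      simp [hj]
    · simp
  have hμ0 : ∀ k, 0 ≤ μ k := fun k => by
    rw [hμe]
    exact nsq_nonneg _
  have hμ1 : ∀ k, μ k ≤ l₁ ^ 2 := by
    intro k
    have h1 : nsq (U *ᵥ Pi.single k 1) = 1 := by
      rw [nsq_mulVec_of_unitary hU', nsq, Finset.sum_eq_single k]
      · simp
      · intro j _ hj
        simp [hj]
      · simp
    rw [hμe, hAx, hEn]
    refine (hup _).trans ?_
    rw [nsq_mulVec_of_unitary hVV, hEn, sq]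
    refine mul_le_mul_of_nonneg_left ((hup _).trans ?_) hl₁
    rw [h1, mul_one]
  have hm : ∀ k, 0 ≤ √(μ k) := fun k => Real.sqrt_nonneg _
  obtain ⟨k₀, hk₀⟩ := Finite.exists_max fun k => √(μ k)
  -- Three linear conditions in dimension four: `x` and `V E x` avoid the null direction of `E`, so
  -- each `E` shrinks by at most `√l₃`, and `x` is orthogonal to the top singular vector. A min-max
  -- argument then yields the second singular value.
  obtain ⟨x, hx, hx1, hx2, hx3⟩ := exists_ne_zero_of_three_equations (Pi.single (1, 1) 1)
    ((V * E) (1, 1)) (Uᴴ k₀)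
  have hx1' : x (1, 1) = 0 := by simpa using hx1
  have hx2' : (V *ᵥ (E *ᵥ x)) (1, 1) = 0 := by
    rw [mulVec_mulVec]
    exact hx2
  have hx3' : (Uᴴ *ᵥ x) k₀ = 0 := hx3
  have hxpos := nsq_pos hx
  have hge : l₃ ^ 2 * nsq x ≤ nsq (A *ᵥ x) := by
    rw [hAx, hEn]
    refine le_trans ?_ (hlow _ hx2')
    rw [nsq_mulVec_of_unitary hVV, hEn, sq, mul_assoc]
    exact mul_le_mul_of_nonneg_left (hlow x hx1') h₃
  obtain ⟨k₁, hk₁, hk₁'⟩ : ∃ k₁, k₁ ≠ k₀ ∧ l₃ ^ 2 ≤ μ k₁ := by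
    by_contra! hcon
    have hpos : ∃ k, (Uᴴ *ᵥ x) k ≠ 0 := by
      by_contra! h0
      have h1 := hUx x
      have : Uᴴ *ᵥ x = 0 := funext h0
      rw [this] at h1
      simp [nsq] at h1
      rw [nsq] at hxpos
      linarith
    obtain ⟨k, hk⟩ := hpos
    have hlt : ∑ k, μ k * ‖(Uᴴ *ᵥ x) k‖ ^ 2 < ∑ k, l₃ ^ 2 * ‖(Uᴴ *ᵥ x) k‖ ^ 2 := by
      refine Finset.sum_lt_sum (fun j _ => ?_) ⟨k, Finset.mem_univ k, ?_⟩
      · by_cases hj : j = k₀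
        · rw [hj, hx3']; simp
        · exact mul_le_mul_of_nonneg_right (hcon j hj).le (by positivity)
      · have hkk : k ≠ k₀ := fun h => hk (h ▸ hx3')
        exact mul_lt_mul_of_pos_right (hcon k hkk) (by positivity)
    rw [← hsum, ← Finset.mul_sum] at hlt
    have := hUx x
    rw [nsq] at this
    rw [this] at hlt
    linarith
  have hchar' : (spinFlipProduct (W * diagonal (fun k => (weights l₁ l₂ l₃ k : ℂ)) * Wᴴ)).charpoly
      = ∏ k, (X - C (((√(μ k) ^ 2 : ℝ) : ℂ))) := by
    rw [hchar, hUμ]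
    simp only [Real.sq_sqrt (hμ0 _)]
    exact charpoly_conj_diagonal hU _
  rw [concurrence_eq_of_charpoly hm hchar' hk₀]
  have hs : √(μ k₀) + √(μ k₁) ≤ ∑ k, √(μ k) := by
    have hp := Finset.sum_pair (f := fun k => √(μ k)) hk₁.symm
    rw [← hp]
    exact Finset.sum_le_sum_of_subset_of_nonneg (Finset.subset_univ _) fun k _ _ => hm k
  have h0 : √(μ k₀) ≤ l₁ := Real.sqrt_le_iff.2 ⟨hl₁, hμ1 k₀⟩
  have h1 : l₃ ≤ √(μ k₁) := Real.le_sqrt_of_sq_le hk₁'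
  refine max_le (by linarith) (by linarith)

theorem isState_conj {ρ W : Op} (hW : Wᴴ * W = 1) (h : IsState ρ) : IsState (W * ρ * Wᴴ) := by
  refine ⟨h.1.mul_mul_conjTranspose_same W, ?_⟩
  rw [trace_mul_comm, ← Matrix.mul_assoc, hW, Matrix.one_mul, h.2]

theorem famState_isMaximallyEntangledMixed {l₁ l₂ l₃ : ℝ} (h₁₂ : l₂ ≤ l₁) (h₂₃ : l₃ ≤ l₂)
    (h₃ : 0 ≤ l₃) (hsum : l₁ + l₂ + l₃ = 1) :
    IsMaximallyEntangledMixed (famState l₁ l₂ l₃) := by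
  have hl₂ : 0 ≤ l₂ := h₃.trans h₂₃
  refine ⟨famState_isState (hl₂.trans h₁₂) hl₂ h₃ hsum, fun U hU => ?_⟩
  rw [concurrence_famState h₃ (h₂₃.trans h₁₂)]
  have hU' : U * Uᴴ = 1 := mem_unitaryGroup_iff.1 hU
  have hW : (U * bellFrame) * (U * bellFrame)ᴴ = 1 := by
    rw [conjTranspose_mul, Matrix.mul_assoc, ← Matrix.mul_assoc bellFrame,
      bellFrame_mul_conjTranspose, Matrix.one_mul, hU']
  have e : U * famState l₁ l₂ l₃ * Uᴴ = (U * bellFrame)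
      * diagonal (fun k => (weights l₁ l₂ l₃ k : ℂ)) * (U * bellFrame)ᴴ := by
    rw [famState, conjTranspose_mul]
    simp only [Matrix.mul_assoc]
  rw [e]
  exact concurrence_conj_diagonal_le hW h₁₂ h₂₃ h₃

theorem isMaximallyEntangledMixed_local {U V : Matrix (Fin 2) (Fin 2) ℂ} (hU : U * Uᴴ = 1)
    (hV : V * Vᴴ = 1) {ρ : Op} (h : IsMaximallyEntangledMixed ρ) :
    IsMaximallyEntangledMixed ((U ⊗ₖ V) * ρ * (U ⊗ₖ V)ᴴ) := by
  have hW := kronecker_mul_conjTranspose hU hV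
  refine ⟨isState_conj (mul_eq_one_comm.1 hW) h.1, fun T hT => ?_⟩
  rw [concurrence_local hU hV]
  have hT' : T * (U ⊗ₖ V) ∈ unitaryGroup (Fin 2 × Fin 2) ℂ :=
    mul_mem hT (mem_unitaryGroup_iff.2 hW)
  have := h.2 _ hT'
  rw [conjTranspose_mul] at this
  simpa only [Matrix.mul_assoc] using this

/-! ### Mixtures with an orthogonal product vector -/

/-- The vector `(|01⟩ + |10⟩)/√2`. -/
def psiPlus : Vec := fun i => ![![0, ((√2 / 2 : ℝ) : ℂ)], ![((√2 / 2 : ℝ) : ℂ), 0]] i.1 i.2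

theorem mixture_psiPlus (c : ℝ) :
    mixture c psiPlus (Pi.single (0, 0) 1) = famState c (1 - c) 0 := by
  have h := half_sqrt_two_mul_self
  rw [famState_eq]
  refine op_ext fun i j k l => ?_
  simp only [mixture, proj, psiPlus, Matrix.add_apply, Matrix.smul_apply, vecMulVec_apply,
    Pi.star_apply]
  generalize hs : ((√2 / 2 : ℝ) : ℂ) = s at *
  have hr : (starRingEnd ℂ) s = s := by rw [← hs]; exact Complex.conj_ofReal _
  fin_cases i <;> fin_cases j <;> fin_cases k <;> fin_cases l <;> simp [hr, h, div_eq_mul_inv]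

theorem proj_mulVec (W : Op) (x : Vec) : proj (W *ᵥ x) = W * proj x * Wᴴ := by
  rw [proj, proj, star_mulVec, mul_vecMulVec, vecMulVec_mul]

theorem proj_smul {w : ℂ} (hw : w * star w = 1) (x : Vec) : proj (w • x) = proj x := by
  ext i j
  simp only [proj, vecMulVec_apply, Pi.smul_apply, Pi.star_apply, smul_eq_mul, star_mul']
  linear_combination x i * star (x j) * hw

theorem mixture_conj (c : ℝ) (W : Op) (x y : Vec) :
    mixture c (W *ᵥ x) (W *ᵥ y) = W * mixture c x y * Wᴴ := by
  rw [mixture, mixture, proj_mulVec, proj_mulVec]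
  simp only [Matrix.mul_add, Matrix.add_mul, Matrix.mul_smul, Matrix.smul_mul]

theorem exists_unitary_of_unit {u : Fin 2 → ℂ} (hu : star (u 0) * u 0 + star (u 1) * u 1 = 1) :
    ∃ U : Matrix (Fin 2) (Fin 2) ℂ, U * Uᴴ = 1 ∧ ∀ i, U i 0 = u i := by
  refine ⟨!![u 0, -star (u 1); u 1, star (u 0)], ?_, ?_⟩
  · have hu' : (starRingEnd ℂ) (u 0) * u 0 + (starRingEnd ℂ) (u 1) * u 1 = 1 := hu
    ext i j
    fin_cases i <;> fin_cases j <;> simp [mul_apply, Fin.sum_univ_two]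
    · linear_combination hu'
    · ring
    · ring
    · linear_combination hu'
  · intro i
    fin_cases i <;> simp

theorem exists_local_unitary_of_product {φ : Vec} (hφ : IsProductVec φ) :
    ∃ U V : Matrix (Fin 2) (Fin 2) ℂ, U * Uᴴ = 1 ∧ V * Vᴴ = 1 ∧
      ∀ i j, φ (i, j) = U i 0 * V j 0 := by
  obtain ⟨hn, u, v, huv⟩ := hφ
  have e : ∀ w : ℂ, star w * w = ((‖w‖ ^ 2 : ℝ) : ℂ) := by
    intro w
    rw [Complex.ofReal_pow]
    exact Complex.conj_mul' w
  set a := ‖u 0‖ ^ 2 + ‖u 1‖ ^ 2 with ha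
  set b := ‖v 0‖ ^ 2 + ‖v 1‖ ^ 2 with hb
  have hab : a * b = 1 := by
    rw [dotProduct, sum_idx] at hn
    simp only [Pi.star_apply, e, huv, norm_mul] at hn
    have : (‖u 0‖ * ‖v 0‖) ^ 2 + (‖u 0‖ * ‖v 1‖) ^ 2 + (‖u 1‖ * ‖v 0‖) ^ 2
      + (‖u 1‖ * ‖v 1‖) ^ 2 = 1 := by exact_mod_cast hn
    rw [ha, hb]
    linarith
  have ha0 : 0 ≤ a := by positivity
  have hb0 : 0 ≤ b := by positivity
  -- Only the product of the squared norms of `u` and `v` is `1`; rescaling `u` by `√b` and `v` by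
  -- `√a` makes both unit vectors without changing `u ⊗ v`.
  have hs : √b * √a = 1 := by rw [← Real.sqrt_mul hb0, mul_comm, hab, Real.sqrt_one]
  have hunit : ∀ (u : Fin 2 → ℂ) (r : ℝ), 0 ≤ r → (‖u 0‖ ^ 2 + ‖u 1‖ ^ 2) * r = 1 →
      star ((fun i => (√r : ℂ) * u i) 0) * ((fun i => (√r : ℂ) * u i) 0)
        + star ((fun i => (√r : ℂ) * u i) 1) * ((fun i => (√r : ℂ) * u i) 1) = 1 := by
    intro u r hr h
    rw [e, e, ← Complex.ofReal_add]
    simp only [norm_mul, Complex.norm_real, Real.norm_of_nonneg (Real.sqrt_nonneg r), mul_pow,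
      Real.sq_sqrt hr]
    exact_mod_cast (by linarith : r * ‖u 0‖ ^ 2 + r * ‖u 1‖ ^ 2 = 1)
  obtain ⟨U, hU, hU'⟩ := exists_unitary_of_unit (u := fun i => (√b : ℂ) * u i) (hunit u b hb0 hab)
  obtain ⟨V, hV, hV'⟩ := exists_unitary_of_unit (u := fun i => (√a : ℂ) * v i)
    (hunit v a ha0 (by rwa [mul_comm]))
  refine ⟨U, V, hU, hV, fun i j => ?_⟩
  have hs' : (√b : ℂ) * √a = 1 := by exact_mod_cast hs
  rw [huv, hU', hV']
  linear_combination (-(u i * v j)) * hs'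

/-- A maximally entangled vector orthogonal to `|00⟩` is of the form `x |01⟩ + y |10⟩` with
`|x| = |y| = 1/√2`. -/
theorem entries_of_orthogonal {P : Matrix (Fin 2) (Fin 2) ℂ} (hP : P * Pᴴ = (1 / 2 : ℂ) • 1)
    (h0 : P 0 0 = 0) : P 1 1 = 0 ∧ P 0 1 * star (P 0 1) = 1 / 2 ∧
      P 1 0 * star (P 1 0) = 1 / 2 := by
  have h := fun i j => congrFun (congrFun hP i) j
  simp only [mul_apply, Fin.sum_univ_two, conjTranspose_apply, Matrix.smul_apply] at h
  have h00 := h 0 0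
  have h10 := h 1 0
  have h11 := h 1 1
  simp only [h0, zero_add, star_zero, mul_zero, one_apply_eq, smul_eq_mul, mul_one,
    one_apply_ne one_ne_zero] at h00 h10 h11
  have hne : star (P 0 1) ≠ 0 := by
    intro hz
    rw [hz, mul_zero] at h00
    norm_num at h00
  have hz : P 1 1 = 0 := by
    rcases mul_eq_zero.1 h10 with h | h
    · exact h
    · exact absurd h hne
  rw [hz, zero_mul, add_zero] at h11
  exact ⟨hz, h00, h11⟩

theorem exists_mixture_eq_famState_conj {ψ φ : Vec} (hψ : IsMaximallyEntangledVec ψ)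
    (hφ : IsProductVec φ) (hψφ : star ψ ⬝ᵥ φ = 0) :
    ∃ U V : Matrix (Fin 2) (Fin 2) ℂ, U * Uᴴ = 1 ∧ V * Vᴴ = 1 ∧ ∀ c : ℝ,
      mixture c ψ φ = (U ⊗ₖ V) * famState c (1 - c) 0 * (U ⊗ₖ V)ᴴ := by
  obtain ⟨U, V, hU, hV, hUV⟩ := exists_local_unitary_of_product hφ
  have hU' : Uᴴ * U = 1 := mul_eq_one_comm.1 hU
  have hV' : Vᴴ * V = 1 := mul_eq_one_comm.1 hV
  have hVt : Vᵀ * (Vᵀ)ᴴ = 1 := by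
    have : Vᵀ * (Vᵀ)ᴴ = (Vᴴ * V)ᵀ := by rw [transpose_mul]; rfl
    rw [this, hV', transpose_one]
  have hVt' : (Vᵀ)ᴴ * Vᵀ = 1 := mul_eq_one_comm.1 hVt
  obtain ⟨Ψ, hΨ⟩ : ∃ Ψ : Matrix (Fin 2) (Fin 2) ℂ, ∀ i j, Ψ i j = ψ (i, j) :=
    ⟨Matrix.of fun i j => ψ (i, j), fun _ _ => rfl⟩
  have hΨΨ : Ψ * Ψᴴ = (1 / 2 : ℂ) • 1 := by
    ext i i'
    rw [mul_apply]
    simp only [conjTranspose_apply, hΨ]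
    refine (hψ i i').trans ?_
    simp [one_apply]
  -- Coefficient matrix of `ψ` in local bases where `φ` becomes `|00⟩`; maximal entanglement makes
  -- `√2 P` unitary and orthogonality makes `P 0 0` vanish.
  set P : Matrix (Fin 2) (Fin 2) ℂ := Uᴴ * Ψ * (Vᵀ)ᴴ with hP
  have hPP : P * Pᴴ = (1 / 2 : ℂ) • 1 := by
    rw [hP, conjTranspose_mul, conjTranspose_mul, conjTranspose_conjTranspose,
      conjTranspose_conjTranspose]
    calc Uᴴ * Ψ * (Vᵀ)ᴴ * (Vᵀ * (Ψᴴ * U)) = Uᴴ * (Ψ * ((Vᵀ)ᴴ * Vᵀ) * Ψᴴ) * U := by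
          simp only [Matrix.mul_assoc]
      _ = (1 / 2 : ℂ) • 1 := by
          rw [hVt', Matrix.mul_one, hΨΨ, Matrix.mul_smul, Matrix.mul_one, Matrix.smul_mul, hU']
  have hΨP : Ψ = U * P * Vᵀ := by
    rw [hP]
    calc Ψ = (U * Uᴴ) * Ψ * ((Vᵀ)ᴴ * Vᵀ) := by rw [hU, hVt', Matrix.one_mul, Matrix.mul_one]
      _ = U * (Uᴴ * Ψ * (Vᵀ)ᴴ) * Vᵀ := by simp only [Matrix.mul_assoc]
  have hP0 : P 0 0 = 0 := by
    have h := congrArg star hψφ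
    rw [star_zero, dotProduct, sum_idx] at h
    simp only [hUV, Pi.star_apply, star_add, star_mul', star_star] at h
    rw [hP]
    simp only [mul_apply, Fin.sum_univ_two, conjTranspose_apply, transpose_apply, hΨ]
    linear_combination h
  obtain ⟨hP1, hx, hy⟩ := entries_of_orthogonal hPP hP0
  set x := P 0 1
  set y := P 1 0
  have hy0 : y ≠ 0 := by
    intro h
    rw [h, zero_mul] at hy
    norm_num at hy
  set s : ℂ := ((√2 / 2 : ℝ) : ℂ) with hs
  have hss : s * s = 1 / 2 := half_sqrt_two_mul_self
  have hsr : star s = s := Complex.conj_ofReal _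
  have hs0 : s ≠ 0 := by
    intro h
    rw [h, zero_mul] at hss
    norm_num at hss
  -- The relative phase of the two entries is absorbed by `diag(1, z)` on the second qubit; the
  -- remaining phase `y / s` is global and disappears in the projection.
  set z := x / y with hz
  have hzz : z * star z = 1 := by
    rw [hz, star_div₀, div_mul_div_comm, hx, hy]
    norm_num
  have hww : y / s * star (y / s) = 1 := by
    rw [star_div₀, div_mul_div_comm, hy, hsr, hss]
    norm_num
  set Z : Matrix (Fin 2) (Fin 2) ℂ := !![1, 0; 0, z] with hZ
  have hZZ : Z * Zᴴ = 1 := by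
    have hzz' : z * (starRingEnd ℂ) z = 1 := hzz
    ext i j
    rw [mul_apply, Fin.sum_univ_two]
    fin_cases i <;> fin_cases j <;> simp [hZ, hzz']
  have hVZ : (V * Z) * (V * Z)ᴴ = 1 := by
    rw [conjTranspose_mul, Matrix.mul_assoc, ← Matrix.mul_assoc Z, hZZ, Matrix.one_mul, hV]
  refine ⟨U, V * Z, hU, hVZ, fun c => ?_⟩
  have hφ' : φ = (U ⊗ₖ (V * Z)) *ᵥ Pi.single (0, 0) 1 := by
    ext ⟨i, j⟩
    rw [mulVec_single_one, col_apply, kroneckerMap_apply, hUV]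
    simp [hZ, mul_apply]
  have hψ' : ψ = (y / s) • ((U ⊗ₖ (V * Z)) *ᵥ psiPlus) := by
    ext ⟨i, j⟩
    have h1 : ψ (i, j) = (U * P * Vᵀ) i j := by rw [← hΨP, hΨ]
    rw [h1]
    simp only [Pi.smul_apply, mulVec, dotProduct, sum_idx, psiPlus, kroneckerMap_apply, mul_apply,
      Fin.sum_univ_two, transpose_apply, hP0, hP1, smul_eq_mul]
    simp only [← hs, hZ]
    simp
    field_simp
    have hxz : x = y * z := by rw [hz]; field_simp
    change U i 1 * y * V j 0 + U i 0 * x * V j 1 = _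
    rw [hxz]
    ring
  rw [← mixture_psiPlus, ← mixture_conj, ← hφ']
  rw [mixture, mixture, hψ', proj_smul hww]

/-! ### Optimal states at each concurrence -/

theorem maxCHSH_famState {l₁ l₂ l₃ : ℝ} (h₁ : 0 ≤ l₁) (h₂ : 0 ≤ l₂) (h₃ : 0 ≤ l₃)
    (hsum : l₁ + l₂ + l₃ = 1) (h : |l₂ - l₁ - l₃| ≤ l₁ - l₃) :
    maxCHSH (famState l₁ l₂ l₃) = √2 * (l₁ - l₃) := by
  refine (maxCHSH_famState_le_sqrt_two_mul h).antisymm ?_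
  have h31 : l₃ ≤ l₁ := by linarith [abs_nonneg (l₂ - l₁ - l₃)]
  have := sqrt_two_mul_concurrence_le_maxCHSH (famState_isState h₁ h₂ h₃ hsum).1
  rwa [concurrence_famState h₃ h31] at this

theorem max_one_maxCHSH_famState {l₁ l₂ l₃ : ℝ} (h₁ : 0 ≤ l₁) (h₂ : 0 ≤ l₂) (h₃ : 0 ≤ l₃)
    (hsum : l₁ + l₂ + l₃ = 1) (h31 : l₃ ≤ l₁)
    (h : 2 * (l₁ - l₃) ^ 2 + (l₂ - l₁ - l₃) ^ 2 ≤ 1 ∨ |l₂ - l₁ - l₃| ≤ l₁ - l₃) :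
    max 1 (maxCHSH (famState l₁ l₂ l₃)) = max 1 (√2 * (l₁ - l₃)) := by
  rcases h with h | h
  · have hle := maxCHSH_famState_le_one h
    have hge := sqrt_two_mul_concurrence_le_maxCHSH (famState_isState h₁ h₂ h₃ hsum).1
    rw [concurrence_famState h₃ h31] at hge
    rw [max_eq_left hle, max_eq_left (hge.trans hle)]
  · rw [maxCHSH_famState h₁ h₂ h₃ hsum h]

/-- At every concurrence there is a state whose maximal CHSH value is the least possible one. -/
theorem exists_state_maxCHSH_eq {c : ℝ} (h0 : 0 ≤ c) (h1 : c ≤ 1) :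
    ∃ ρ : Op, IsState ρ ∧ concurrence ρ = c ∧ maxCHSH ρ = √2 * c := by
  rcases le_total (1 / 3) c with h | h
  · have hs : c + (1 - c) + 0 = 1 := by ring
    refine ⟨famState c (1 - c) 0, famState_isState h0 (by linarith) le_rfl hs, ?_, ?_⟩
    · rw [concurrence_famState le_rfl h0, sub_zero]
    · rw [maxCHSH_famState h0 (by linarith) le_rfl hs, sub_zero]
      rw [abs_le]
      constructor <;> linarith
  -- For `c < 1/3` the weights `c, 1 - c, 0` violate `|l₂ - l₁ - l₃| ≤ l₁ - l₃`; taking `l₂ = 1/2`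
  -- makes the third correlation vanish while `l₁ - l₃ = c`.
  · have hs : (1 / 4 + c / 2) + 1 / 2 + (1 / 4 - c / 2) = 1 := by ring
    have e : 1 / 4 + c / 2 - (1 / 4 - c / 2) = c := by ring
    refine ⟨famState (1 / 4 + c / 2) (1 / 2) (1 / 4 - c / 2),
      famState_isState (by linarith) (by norm_num) (by linarith) hs, ?_, ?_⟩
    · rw [concurrence_famState (by linarith) (by linarith), e]
    · rw [maxCHSH_famState (by linarith) (by norm_num) (by linarith) hs, e]
      rw [abs_le]
      constructor <;> linarith

theorem exists_maximallyEntangledMixed {c : ℝ} (h0 : 0 ≤ c) (h1 : c ≤ 1) :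
    ∃ ρ : Op, IsMaximallyEntangledMixed ρ ∧ ρ.rank < 4 ∧ concurrence ρ = c ∧
      max 1 (maxCHSH ρ) = max 1 (√2 * c) := by
  rcases le_total (1 / 2) c with h | h
  · have hs : c + (1 - c) + 0 = 1 := by ring
    refine ⟨famState c (1 - c) 0, famState_isMaximallyEntangledMixed (by linarith) (by linarith)
      le_rfl hs, rank_famState_lt _ _ _, ?_, ?_⟩
    · rw [concurrence_famState le_rfl h0, sub_zero]
    · rw [max_one_maxCHSH_famState h0 (by linarith) le_rfl hs h0 (Or.inr ?_), sub_zero]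
      rw [abs_le]
      constructor <;> linarith
  -- For `c < 1/2` the weights `c, 1 - c, 0` are not in decreasing order. Equal `l₁ = l₂` with
  -- difference `c` to `l₃` restore the order, and the trace fixes `l₃ = x`; the Frobenius bound
  -- then gives `β ≤ 1`.
  · set x := (1 - 2 * c) / 3 with hx
    have hs : (c + x) + (c + x) + x = 1 := by rw [hx]; ring
    have hx0 : 0 ≤ x := by rw [hx]; linarith
    have e : c + x - x = c := by ring
    refine ⟨famState (c + x) (c + x) x, famState_isMaximallyEntangledMixed le_rfl (by linarith)
      hx0 hs, rank_famState_lt _ _ _, ?_, ?_⟩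
    · rw [concurrence_famState hx0 (by linarith), e]
    · rw [max_one_maxCHSH_famState (by linarith) (by linarith) hx0 hs (by linarith) (Or.inl ?_), e]
      have e2 : c + x - (c + x) - x = -x := by ring
      rw [e, e2]
      nlinarith

theorem mixture_properties {ψ φ : Vec} (hψ : IsMaximallyEntangledVec ψ) (hφ : IsProductVec φ)
    (hψφ : star ψ ⬝ᵥ φ = 0) {c : ℝ} (h0 : 0 ≤ c) (h1 : c ≤ 1) :
    IsState (mixture c ψ φ) ∧ (mixture c ψ φ).rank < 4 ∧ concurrence (mixture c ψ φ) = c ∧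
      max 1 (maxCHSH (mixture c ψ φ)) = max 1 (√2 * c) ∧
      (1 / 3 ≤ c → maxCHSH (mixture c ψ φ) = √2 * c) ∧
      (1 / 2 ≤ c → IsMaximallyEntangledMixed (mixture c ψ φ)) := by
  obtain ⟨U, V, hU, hV, hUV⟩ := exists_mixture_eq_famState_conj hψ hφ hψφ
  have hs : c + (1 - c) + 0 = 1 := by ring
  have habs : 1 / 3 ≤ c → |1 - c - c - 0| ≤ c - 0 := by
    intro h
    rw [abs_le]
    constructor <;> linarith
  rw [hUV, concurrence_local hU hV, maxCHSH_local hU hV]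
  refine ⟨isState_conj (mul_eq_one_comm.1 (kronecker_mul_conjTranspose hU hV))
    (famState_isState h0 (by linarith) le_rfl hs), ?_, ?_, ?_, fun h => ?_, fun h => ?_⟩
  · exact (rank_mul_le_left _ _).trans_lt ((rank_mul_le_right _ _).trans_lt
      (rank_famState_lt _ _ _))
  · rw [concurrence_famState le_rfl h0, sub_zero]
  · rw [max_one_maxCHSH_famState h0 (by linarith) le_rfl hs h0 ?_, sub_zero]
    rcases le_total (1 / 3) c with h | h
    · exact Or.inr (habs h)
    · left
      nlinarith
  · rw [maxCHSH_famState h0 (by linarith) le_rfl hs (habs h), sub_zero]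
  · exact isMaximallyEntangledMixed_local hU hV
      (famState_isMaximallyEntangledMixed (by linarith) (by linarith) le_rfl hs)

end

end TwoQubit

theorem theorem2 :
    -- every state satisfies `√2 C(ρ) ≤ β(ρ)`
    (∀ ρ : TwoQubit.Op, TwoQubit.IsState ρ →
      √2 * TwoQubit.concurrence ρ ≤ TwoQubit.maxCHSH ρ) ∧
    -- the minimal violation (counted from the classical bound `1`) and the minimal maximal CHSH
    -- value, at fixed concurrence
    (∀ c : ℝ, 0 ≤ c → c ≤ 1 →
      IsLeast {t : ℝ | ∃ ρ : TwoQubit.Op, TwoQubit.IsState ρ ∧ TwoQubit.concurrence ρ = c ∧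
        t = max 1 (TwoQubit.maxCHSH ρ)} (max 1 (√2 * c)) ∧
      IsLeast {t : ℝ | ∃ ρ : TwoQubit.Op, TwoQubit.IsState ρ ∧ TwoQubit.concurrence ρ = c ∧
        t = TwoQubit.maxCHSH ρ} (√2 * c)) ∧
    -- the minimum is attained by a rank-deficient maximally entangled mixed state
    (∀ c : ℝ, 0 ≤ c → c ≤ 1 →
      ∃ ρ : TwoQubit.Op, TwoQubit.IsMaximallyEntangledMixed ρ ∧ ρ.rank < 4 ∧
        TwoQubit.concurrence ρ = c ∧ max 1 (TwoQubit.maxCHSH ρ) = max 1 (√2 * c)) ∧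
    -- mixtures of a maximally entangled pure state and an orthogonal product pure state
    (∀ ψ φ : TwoQubit.Vec, TwoQubit.IsMaximallyEntangledVec ψ → TwoQubit.IsProductVec φ →
      star ψ ⬝ᵥ φ = 0 → ∀ c : ℝ, 0 ≤ c → c ≤ 1 →
        TwoQubit.IsState (TwoQubit.mixture c ψ φ) ∧
        (TwoQubit.mixture c ψ φ).rank < 4 ∧
        TwoQubit.concurrence (TwoQubit.mixture c ψ φ) = c ∧
        max 1 (TwoQubit.maxCHSH (TwoQubit.mixture c ψ φ)) = max 1 (√2 * c) ∧
        (1 / 3 ≤ c → TwoQubit.maxCHSH (TwoQubit.mixture c ψ φ) = √2 * c) ∧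
        (1 / 2 ≤ c → TwoQubit.IsMaximallyEntangledMixed (TwoQubit.mixture c ψ φ))) := by
  refine ⟨fun ρ hρ => TwoQubit.sqrt_two_mul_concurrence_le_maxCHSH hρ.1, fun c h0 h1 => ?_,
    fun c h0 h1 => TwoQubit.exists_maximallyEntangledMixed h0 h1,
    fun ψ φ hψ hφ hψφ c h0 h1 => TwoQubit.mixture_properties hψ hφ hψφ h0 h1⟩
  obtain ⟨ρ, hρ, hc, hβ⟩ := TwoQubit.exists_state_maxCHSH_eq h0 h1
  refine ⟨⟨⟨ρ, hρ, hc, by rw [hβ]⟩, ?_⟩, ⟨⟨ρ, hρ, hc, hβ.symm⟩, ?_⟩⟩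
  · rintro t ⟨σ, hσ, rfl, rfl⟩
    exact max_le_max le_rfl (TwoQubit.sqrt_two_mul_concurrence_le_maxCHSH hσ.1)
  · rintro t ⟨σ, hσ, rfl, rfl⟩
    exact TwoQubit.sqrt_two_mul_concurrence_le_maxCHSH hσ.1
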